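/- Let $\mathbb K=\mathbb R$ or $\mathbb C$, or more generally any complete nontrivially normed field of characteristic $0$. "Smooth" means $C^\infty$ over $\mathbb R$ and $\mathbb C$, and analytic over every other $\mathbb K$. Let $m\ge 1$ and $n\ge 2$. Consider the family of all homogeneous linear systems $$y^{(n)}+B_n^1(x)\,y^{(n-1)}+\dots+B_n^n(x)\,y=0,\qquad y=y(x)\in\mathbb K^m, \tag{1}$$ whose coefficients $B_n^k$ are arbitrary smooth $m\times m$ matrix functions of $x$, and the subfamily of the systems in normal form, i.e. those with $B_n^1=0$. A point transformation is a smooth bijection $(z,w)\mapsto(x,y)$ with smooth inverse between two open subsets of $\mathbb K\times\mathbb K^m$. It belongs to the equivalence group of a family if, locally near every point of its domain, it turns every system of the family for $y$ as a function of $x$ into a system of the same family for $w$ as a function of $z$. (a) A point transformation belongs to the equivalence group of the family (1) if and only if, near every point of its domain, it has the form $$x=f(z),\qquad y=T(z)\,w,$$ where $f$ is a smooth scalar function with $f'\neq 0$, and $T$ is a smooth function whose values are invertible $m\times m$ matrices. (b) A point transformation belongs to the equivalence group of the family of systems in normal form if and only if, near every point of its domain, it has the form $$x=f(z),\qquad y=f'(z)^{(n-1)/2}\,C\,w,$$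 where $f$ is a smooth scalar function with $f'\neq0$, and $C$ is a constant invertible $m\times m$ matrix over $\mathbb K$. Here $f'^{(n-1)/2}$ stands for a smooth function $g$ with $g^2=c\,f'^{\,n-1}$ for some constant $c\in\mathbb K\setminus\{0\}$ (over $\mathbb R$ this is $|f'|^{(n-1)/2}$, up to a constant factor that can be absorbed into $C$). (c) If for every $z$ the set of all $w$ with $(z,w)$ in the domain is connected or empty, then "near every point of its domain" in (a) can be replaced by "on its whole domain", with a single $f$ and a single $T$. If moreover the projection of the domain to the $z$-axis is connected, then the same replacement can be made in (b), with a single $f$, $g$, $c$ and $C$. -/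

import Mathlib

open scoped ContDiff Matrix Topology

namespace LinearSystem

/-- The order of differentiability that "smooth" stands for over `𝕜`: it is `C^∞` over the real
and the complex numbers, and analytic over every other complete normed field (where functions that
are merely `C^∞` need not be locally constant when their derivative vanishes). -/
noncomputable abbrev smooth (𝕜 : Type*) [NontriviallyNormedField 𝕜] : WithTop ℕ∞ :=
  minSmoothness 𝕜 ∞

/-- The coefficients `B k`, for `1 ≤ k ≤ n`, of a homogeneous linear system
`y^(n) + B 1 y^(n-1) + ⋯ + B n y = 0` in `m` unknown functions. The other values of `k` are never
used. -/
abbrev Coeffs (𝕜 : Type*) (m : ℕ) : Type _ := ℕ → 𝕜 → Matrix (Fin m) (Fin m) 𝕜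

/-- The jet `j` (that is, `j k` is the value of the `k`-th derivative) satisfies at the point `x`
the system `y^(n) + B 1 y^(n-1) + ⋯ + B n y = 0`. -/
def HoldsAt {𝕜 : Type*} [NontriviallyNormedField 𝕜] {m : ℕ} (n : ℕ) (B : Coeffs 𝕜 m) (x : 𝕜)
    (j : ℕ → Fin m → 𝕜) : Prop :=
  j n + ∑ k ∈ Finset.Icc 1 n, B k x *ᵥ j (n - k) = 0

/-- The systems `y^(n) + B 1 y^(n-1) + ⋯ + B n y = 0` with arbitrary smooth coefficients, near
the point `x₀`. -/
def GeneralFamily {𝕜 : Type*} [NontriviallyNormedField 𝕜] {m : ℕ} (n : ℕ) (B : Coeffs 𝕜 m)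
    (x₀ : 𝕜) : Prop :=
  ∀ᶠ x in 𝓝 x₀, ∀ k ∈ Finset.Icc 1 n, ∀ i j, ContDiffAt 𝕜 (smooth 𝕜) (fun t => B k t i j) x

/-- The systems in normal form, near the point `x₀`: the coefficient of the term of order `n - 1`
vanishes, and the others are arbitrary smooth functions. -/
def NormalFamily {𝕜 : Type*} [NontriviallyNormedField 𝕜] {m : ℕ} (n : ℕ) (B : Coeffs 𝕜 m)
    (x₀ : 𝕜) : Prop :=
  GeneralFamily n B x₀ ∧ ∀ᶠ x in 𝓝 x₀, B 1 x = 0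

/-- An invertible point transformation `(z, w) ↦ (x, y)`: a smooth bijection, with smooth inverse,
between two open sets of the space of one independent and `m` dependent variables. -/
def IsPointTransformation {𝕜 : Type*} [NontriviallyNormedField 𝕜] {m : ℕ}
    (e : OpenPartialHomeomorph (𝕜 × (Fin m → 𝕜)) (𝕜 × (Fin m → 𝕜))) : Prop :=
  ContDiffOn 𝕜 (smooth 𝕜) e e.source ∧ ContDiffOn 𝕜 (smooth 𝕜) e.symm e.target

/-- The derivatives of `y` with respect to `x` along the curve `x = F z`, `y = Y z`, as functions
of the parameter `z`: the zeroth one is `Y`, and the next one is always obtained by applying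
`d/dx = (1 / F') d/dz`. -/
noncomputable def derivAlong {𝕜 : Type*} [NontriviallyNormedField 𝕜] {m : ℕ} (F : 𝕜 → 𝕜)
    (Y : 𝕜 → Fin m → 𝕜) : ℕ → 𝕜 → Fin m → 𝕜
  | 0 => Y
  | k + 1 => fun z => (deriv F z)⁻¹ • deriv (derivAlong F Y k) z

/-- At the point `q = (z, w)`, the substitution `(x, y) = e (z, w)` turns the system with
coefficients `B` for `y` as a function of `x` into the system with coefficients `H` for `w` as a
function of `z`. Here `w` is an arbitrary smooth function, with graph through `q`, whose graph is
mapped by `e` to the graph of a function `y` of `x` (that is, `dx/dz ≠ 0`). -/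
def TransformsAt {𝕜 : Type*} [NontriviallyNormedField 𝕜] {m : ℕ} (n : ℕ)
    (e : OpenPartialHomeomorph (𝕜 × (Fin m → 𝕜)) (𝕜 × (Fin m → 𝕜)))
    (B H : Coeffs 𝕜 m) (q : 𝕜 × (Fin m → 𝕜)) : Prop :=
  ∀ w : 𝕜 → Fin m → 𝕜, ContDiffAt 𝕜 (smooth 𝕜) w q.1 → w q.1 = q.2 →
    deriv (fun z => (e (z, w z)).1) q.1 ≠ 0 →
    (HoldsAt n B (e q).1
        (fun k => derivAlong (fun z => (e (z, w z)).1) (fun z => (e (z, w z)).2) k q.1) ↔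
      HoldsAt n H q.1 (fun k => iteratedDeriv k w q.1))

/-- The point transformation `e` belongs to the equivalence group of the given family of systems of
order `n`: it turns every system of the family into a system of the same family. As usual for point
transformations, which are defined on open sets only, this is understood locally. -/
def IsEquivalence {𝕜 : Type*} [NontriviallyNormedField 𝕜] {m : ℕ} (n : ℕ)
    (Family : Coeffs 𝕜 m → 𝕜 → Prop)
    (e : OpenPartialHomeomorph (𝕜 × (Fin m → 𝕜)) (𝕜 × (Fin m → 𝕜))) : Prop :=
  ∀ p ∈ e.source, ∀ B : Coeffs 𝕜 m, Family B (e p).1 →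
    ∃ H : Coeffs 𝕜 m, Family H p.1 ∧ ∀ᶠ q in 𝓝 p, TransformsAt n e B H q

/-- On the set `S` the transformation `e` reads `x = f(z)`, `y = T(z) w` with smooth `f` and `T`,
where `f'` does not vanish and the matrices `T(z)` are invertible. -/
def HasStandardForm {𝕜 : Type*} [NontriviallyNormedField 𝕜] {m : ℕ}
    (e : OpenPartialHomeomorph (𝕜 × (Fin m → 𝕜)) (𝕜 × (Fin m → 𝕜)))
    (S : Set (𝕜 × (Fin m → 𝕜))) : Prop :=
  ∃ (f : 𝕜 → 𝕜) (T : 𝕜 → Matrix (Fin m) (Fin m) 𝕜),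
    (∀ z ∈ Prod.fst '' S, ContDiffAt 𝕜 (smooth 𝕜) f z ∧ deriv f z ≠ 0 ∧
      (∀ i j, ContDiffAt 𝕜 (smooth 𝕜) (fun t => T t i j) z) ∧ IsUnit (T z)) ∧
    ∀ q ∈ S, e q = (f q.1, T q.1 *ᵥ q.2)

/-- On the set `S` the transformation `e` reads `x = f(z)`, `y = f'(z)^((n-1)/2) C w` with smooth
`f`, where `f'` does not vanish, and with a constant invertible matrix `C`. The power is a smooth
function `g` with `g ^ 2 = c * f' ^ (n - 1)` for some constant `c ≠ 0`; a constant `c ≠ 1` is only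
needed if `f' ^ (n - 1)` has no square root over `𝕜`: for example, over the real numbers this gives
`|f'|^((n-1)/2)`, up to a constant factor that `C` absorbs. -/
def HasNormalForm {𝕜 : Type*} [NontriviallyNormedField 𝕜] {m : ℕ} (n : ℕ)
    (e : OpenPartialHomeomorph (𝕜 × (Fin m → 𝕜)) (𝕜 × (Fin m → 𝕜)))
    (S : Set (𝕜 × (Fin m → 𝕜))) : Prop :=
  ∃ (f g : 𝕜 → 𝕜) (c : 𝕜) (C : Matrix (Fin m) (Fin m) 𝕜), c ≠ 0 ∧ IsUnit C ∧
    (∀ z ∈ Prod.fst '' S, ContDiffAt 𝕜 (smooth 𝕜) f z ∧ deriv f z ≠ 0 ∧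
      ContDiffAt 𝕜 (smooth 𝕜) g z ∧ g z ^ 2 = c * deriv f z ^ (n - 1)) ∧
    ∀ q ∈ S, e q = (f q.1, g q.1 • (C *ᵥ q.2))

end LinearSystem

/-! Necessity in (a) and (b) needs only two test systems, `y^(n) = 0` and `y^(n) + y = 0`, which lie
in both families. Let `H₀`, `H₁` be their transforms, `J` the derivative of `e` at `(z, w)`, and `D`
the first component of `J (1, u)`. Take solutions of `H₀` and `H₁` with the same jet `(w, u, 0, …,
0)` below order `n`. They differ at order `n` by a vector affine in `u`, and their images have
`n`-th `x`-derivatives `0` and `-y`. Comparing leading terms (`TransformsAt.sub_mulVec_eq`) shows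
that this vector equals `D ^ n • (a • u - c)`, where `J (a, c) = (0, y)`. If `x` depended on `w`,
then `D` would be a nonconstant affine function of `u`; as `n ≥ 2`, comparing degrees forces `a =
0`, `c = 0`, hence `y = 0` (`eq_zero_of_forall_pow_smul`). This would hold on an open set, against
invertibility of `J`. So `x = f(z)`. Next, `y^(n) = 0` alone gives `y_ww = 0`
(`TransformsAt.fderiv_fderiv_snd_eq_zero`), so `y` is affine in `w`. Finally the comparison identity
at `u = 0` writes `y` as a linear function of `w`, which removes the inhomogeneous term
(`exists_localForm`). Conversely, `x = f(z)`, `y = T(z) w` transforms the coefficients explicitly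
(`pullback`). It keeps the normal form exactly when the coefficient of `w^(n-1)` in `y^(n)`
vanishes, that is, when `T' = (n-1)/2 · f''/f' · T` (`linCoeff_succ_self`). Then `T` divided by a
nonzero entry is locally constant, and so is the square of that entry over `f'^(n-1)`. For (c), `f`
and `T` can be read off from `e` and its derivative, so local forms agree along connected slices;
the constants in (b) are locally constant functions on the projection. -/

namespace LinearSystem

/-! ### Leading terms of derivatives of flat functions. -/

section Calculus

variable {𝕜 : Type*} [NontriviallyNormedField 𝕜]
  {E F G : Type*} [NormedAddCommGroup E] [NormedSpace 𝕜 E] [NormedAddCommGroup F]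
  [NormedSpace 𝕜 F] [NormedAddCommGroup G] [NormedSpace 𝕜 G]

theorem infty_le_smooth : (∞ : WithTop ℕ∞) ≤ smooth 𝕜 := le_minSmoothness

theorem natCast_le_infty (k : ℕ) : (k : WithTop ℕ∞) ≤ ∞ := by exact_mod_cast le_top

theorem natCast_le_smooth (k : ℕ) : (k : WithTop ℕ∞) ≤ smooth 𝕜 :=
  (natCast_le_infty k).trans infty_le_smooth

theorem smooth_add_one_le : smooth 𝕜 + 1 ≤ smooth 𝕜 := by
  unfold smooth
  rw [← minSmoothness_add]
  exact minSmoothness_monotone (by simp)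

theorem minSmoothness_two_le : minSmoothness 𝕜 2 ≤ smooth 𝕜 :=
  minSmoothness_monotone (Nat.cast_ofNat (R := WithTop ℕ∞) (n := 2) ▸ natCast_le_infty 2)

theorem one_le_smooth : (1 : WithTop ℕ∞) ≤ smooth 𝕜 := by
  exact_mod_cast natCast_le_smooth (𝕜 := 𝕜) 1

theorem eventually_differentiableAt {f : E → F} {x : E} (hf : ContDiffAt 𝕜 (smooth 𝕜) f x) :
    ∀ᶠ y in 𝓝 x, DifferentiableAt 𝕜 f y :=
  ((hf.of_le one_le_smooth).eventually (by simp)).mono fun _ h => h.differentiableAt (by simp)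

theorem fderiv_smooth {f : E → F} {x : E} (hf : ContDiffAt 𝕜 (smooth 𝕜) f x) :
    ContDiffAt 𝕜 (smooth 𝕜) (fderiv 𝕜 f) x :=
  hf.fderiv_right smooth_add_one_le

theorem deriv_smooth {f : 𝕜 → F} {x : 𝕜} (hf : ContDiffAt 𝕜 (smooth 𝕜) f x) :
    ContDiffAt 𝕜 (smooth 𝕜) (deriv f) x := by
  have : deriv f = fun y => fderiv 𝕜 f y 1 := by ext y; simp
  rw [this]
  exact (fderiv_smooth hf).clm_apply contDiffAt_const

theorem iteratedDeriv_smooth {f : 𝕜 → F} {x : 𝕜} (hf : ContDiffAt 𝕜 (smooth 𝕜) f x) (k : ℕ) :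
    ContDiffAt 𝕜 (smooth 𝕜) (iteratedDeriv k f) x := by
  induction k with
  | zero => simpa using hf
  | succ k ih => rw [iteratedDeriv_succ]; exact deriv_smooth ih

theorem iteratedDeriv_clm_comp (L : E →L[𝕜] F) (k : ℕ) {f : 𝕜 → E} {x : 𝕜}
    (hf : ContDiffAt 𝕜 (smooth 𝕜) f x) :
    iteratedDeriv k (fun z => L (f z)) x = L (iteratedDeriv k f x) := by
  induction k generalizing f with
  | zero => simp
  | succ k ih =>
    have : deriv (fun z => L (f z)) =ᶠ[𝓝 x] fun z => L (deriv f z) := by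
      filter_upwards [eventually_differentiableAt hf] with z hz
      exact (L.hasFDerivAt.comp_hasDerivAt z hz.hasDerivAt).deriv
    rw [iteratedDeriv_succ', iteratedDeriv_succ', this.iteratedDeriv_eq, ih (deriv_smooth hf)]

/-- All derivatives of `h` of order less than `k` vanish at `x`. -/
def FlatAt (k : ℕ) (h : 𝕜 → E) (x : 𝕜) : Prop :=
  ContDiffAt 𝕜 (smooth 𝕜) h x ∧ ∀ i < k, iteratedDeriv i h x = 0

theorem FlatAt.mono {k l : ℕ} {h : 𝕜 → E} {x : 𝕜} (hh : FlatAt k h x) (hl : l ≤ k) :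
    FlatAt l h x :=
  ⟨hh.1, fun i hi => hh.2 i (hi.trans_le hl)⟩

theorem FlatAt.flat_deriv {k : ℕ} {h : 𝕜 → E} {x : 𝕜} (hh : FlatAt (k + 1) h x) :
    FlatAt k (deriv h) x :=
  ⟨deriv_smooth hh.1, fun i hi => by
    rw [← iteratedDeriv_succ']; exact hh.2 _ (Nat.succ_lt_succ hi)⟩

theorem flatAt_succ {k : ℕ} {h : 𝕜 → E} {x : 𝕜} (hs : ContDiffAt 𝕜 (smooth 𝕜) h x)
    (h0 : h x = 0) (hd : FlatAt k (deriv h) x) : FlatAt (k + 1) h x := by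
  refine ⟨hs, fun i hi => ?_⟩
  cases i with
  | zero => simpa using h0
  | succ i => rw [iteratedDeriv_succ']; exact hd.2 i (by omega)

theorem FlatAt.congr {k : ℕ} {g h : 𝕜 → E} {x : 𝕜} (hh : FlatAt k h x) (hg : g =ᶠ[𝓝 x] h) :
    FlatAt k g x :=
  ⟨hh.1.congr_of_eventuallyEq hg, fun i hi => by rw [hg.iteratedDeriv_eq]; exact hh.2 i hi⟩

theorem FlatAt.add {k : ℕ} {g h : 𝕜 → E} {x : 𝕜} (hg : FlatAt k g x) (hh : FlatAt k h x) :
    FlatAt k (fun z => g z + h z) x :=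
  ⟨hg.1.add hh.1, fun i hi => by
    rw [iteratedDeriv_fun_add (hg.1.of_le (natCast_le_smooth i))
      (hh.1.of_le (natCast_le_smooth i)), hg.2 i hi, hh.2 i hi, add_zero]⟩

theorem FlatAt.clm_comp {k : ℕ} {h : 𝕜 → E} {x : 𝕜} (hh : FlatAt k h x) (L : E →L[𝕜] F) :
    FlatAt k (fun z => L (h z)) x :=
  ⟨L.contDiff.contDiffAt.comp x hh.1, fun i hi => by
    rw [iteratedDeriv_clm_comp L i hh.1, hh.2 i hi, map_zero]⟩

theorem iteratedDeriv_fun_add_smooth (k : ℕ) {g h : 𝕜 → E} {x : 𝕜}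
    (hg : ContDiffAt 𝕜 (smooth 𝕜) g x) (hh : ContDiffAt 𝕜 (smooth 𝕜) h x) :
    iteratedDeriv k (fun z => g z + h z) x = iteratedDeriv k g x + iteratedDeriv k h x :=
  iteratedDeriv_fun_add (hg.of_le (natCast_le_smooth k)) (hh.of_le (natCast_le_smooth k))

theorem iteratedDeriv_fun_sub_smooth (k : ℕ) {g h : 𝕜 → E} {x : 𝕜}
    (hg : ContDiffAt 𝕜 (smooth 𝕜) g x) (hh : ContDiffAt 𝕜 (smooth 𝕜) h x) :
    iteratedDeriv k (fun z => g z - h z) x = iteratedDeriv k g x - iteratedDeriv k h x :=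
  iteratedDeriv_fun_sub (hg.of_le (natCast_le_smooth k)) (hh.of_le (natCast_le_smooth k))

theorem bilin_smooth (B : E →L[𝕜] F →L[𝕜] G) {g : 𝕜 → E} {h : 𝕜 → F} {x : 𝕜}
    (hg : ContDiffAt 𝕜 (smooth 𝕜) g x) (hh : ContDiffAt 𝕜 (smooth 𝕜) h x) :
    ContDiffAt 𝕜 (smooth 𝕜) (fun z => B (g z) (h z)) x :=
  ContDiffAt.clm_apply (B.contDiff.contDiffAt.comp x hg) hh

theorem deriv_bilin (B : E →L[𝕜] F →L[𝕜] G) {g : 𝕜 → E} {h : 𝕜 → F} {x : 𝕜}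
    (hg : ContDiffAt 𝕜 (smooth 𝕜) g x) (hh : ContDiffAt 𝕜 (smooth 𝕜) h x) :
    deriv (fun z => B (g z) (h z)) =ᶠ[𝓝 x] fun z => B (deriv g z) (h z) + B (g z) (deriv h z) := by
  filter_upwards [eventually_differentiableAt hg, eventually_differentiableAt hh] with z h1 h2
  exact (HasDerivAt.clm_apply (B.hasFDerivAt.comp_hasDerivAt z h1.hasDerivAt) h2.hasDerivAt).deriv

/-- In the Leibniz formula only the term with every derivative on the flat factor survives. -/
theorem FlatAt.bilin (B : E →L[𝕜] F →L[𝕜] G) {k : ℕ} {g : 𝕜 → E} {h : 𝕜 → F} {x : 𝕜}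
    (hg : ContDiffAt 𝕜 (smooth 𝕜) g x) (hh : FlatAt k h x) :
    FlatAt k (fun z => B (g z) (h z)) x ∧
      iteratedDeriv k (fun z => B (g z) (h z)) x = B (g x) (iteratedDeriv k h x) := by
  induction k generalizing g h with
  | zero => exact ⟨⟨bilin_smooth B hg hh.1, by simp⟩, by simp⟩
  | succ k ih =>
    have hd := deriv_bilin B hg hh.1
    have h1 := ih (deriv_smooth hg) (hh.mono k.le_succ)
    have h2 := ih hg hh.flat_deriv
    refine ⟨flatAt_succ (bilin_smooth B hg hh.1) ?_ ((h1.1.add h2.1).congr hd), ?_⟩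
    · have := hh.2 0 k.succ_pos
      simp only [iteratedDeriv_zero] at this
      simp [this]
    · rw [iteratedDeriv_succ', hd.iteratedDeriv_eq, iteratedDeriv_fun_add_smooth k h1.1.1 h2.1.1,
        h1.2, h2.2, hh.2 k k.lt_succ_self, iteratedDeriv_succ']
      simp

/-- One order beyond the leading one, a single derivative may fall on `g`, in `k + 1` ways. -/
theorem FlatAt.iteratedDeriv_succ_bilin (B : E →L[𝕜] F →L[𝕜] G) {k : ℕ} {g : 𝕜 → E} {h : 𝕜 → F}
    {x : 𝕜} (hg : ContDiffAt 𝕜 (smooth 𝕜) g x) (hh : FlatAt k h x) :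
    iteratedDeriv (k + 1) (fun z => B (g z) (h z)) x =
      B (g x) (iteratedDeriv (k + 1) h x) +
        ((k + 1 : ℕ) : 𝕜) • B (deriv g x) (iteratedDeriv k h x) := by
  induction k generalizing g h with
  | zero =>
    have hd := (deriv_bilin B hg hh.1).eq_of_nhds
    simp only [zero_add, iteratedDeriv_one, iteratedDeriv_zero, hd, Nat.cast_one, one_smul]
    exact add_comm _ _
  | succ k ih =>
    have hd := deriv_bilin B hg hh.1
    have h1 := FlatAt.bilin B (deriv_smooth hg) hh
    have h2 := ih hg hh.flat_deriv
    rw [iteratedDeriv_succ', hd.iteratedDeriv_eq, iteratedDeriv_fun_add_smooth (k + 1) h1.1.1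
        (bilin_smooth B hg (deriv_smooth hh.1)),
        h1.2, h2, iteratedDeriv_succ' (n := k + 1), iteratedDeriv_succ' (n := k)]
    push_cast
    module

end Calculus

/-! ### Contact of curves under smooth maps. -/

section Contact

universe u

variable {𝕜 : Type u} [NontriviallyNormedField 𝕜]

theorem deriv_comp_curve {E F : Type*} [NormedAddCommGroup E] [NormedSpace 𝕜 E]
    [NormedAddCommGroup F] [NormedSpace 𝕜 F] {g : E → F} {γ : 𝕜 → E} {x : 𝕜}
    (hg : ContDiffAt 𝕜 (smooth 𝕜) g (γ x)) (hγ : ContDiffAt 𝕜 (smooth 𝕜) γ x) :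
    deriv (fun z => g (γ z)) =ᶠ[𝓝 x] fun z => fderiv 𝕜 g (γ z) (deriv γ z) := by
  filter_upwards [eventually_differentiableAt hγ,
    hγ.continuousAt.eventually (eventually_differentiableAt hg)] with z h1 h2
  exact (h2.hasFDerivAt.comp_hasDerivAt z h1.hasDerivAt).deriv

/-- Adding and subtracting `fderiv 𝕜 g (γ z) (deriv δ z)` splits the difference into two bilinear
terms, each with a flat factor, which permits induction on the order of contact. -/
theorem deriv_comp_sub {E F : Type*} [NormedAddCommGroup E] [NormedSpace 𝕜 E]
    [NormedAddCommGroup F] [NormedSpace 𝕜 F] {g : E → F} {γ δ : 𝕜 → E} {x : 𝕜}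
    (hg : ContDiffAt 𝕜 (smooth 𝕜) g (γ x)) (hγ : ContDiffAt 𝕜 (smooth 𝕜) γ x)
    (hδ : ContDiffAt 𝕜 (smooth 𝕜) δ x) (h0 : δ x = γ x) :
    deriv (fun z => g (δ z) - g (γ z)) =ᶠ[𝓝 x] fun z =>
      (ContinuousLinearMap.id 𝕜 (E →L[𝕜] F)).flip (deriv δ z)
        (fderiv 𝕜 g (δ z) - fderiv 𝕜 g (γ z)) +
      ContinuousLinearMap.id 𝕜 (E →L[𝕜] F) (fderiv 𝕜 g (γ z))
        (deriv (fun t => δ t - γ t) z) := by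
  have hg' : ContDiffAt 𝕜 (smooth 𝕜) g (δ x) := h0 ▸ hg
  filter_upwards [eventually_differentiableAt hγ, eventually_differentiableAt hδ,
    hγ.continuousAt.eventually (eventually_differentiableAt hg),
    hδ.continuousAt.eventually (eventually_differentiableAt hg')] with z h1 h2 h3 h4
  rw [deriv_fun_sub h2 h1]
  refine ((h4.hasFDerivAt.comp_hasDerivAt z h2.hasDerivAt).fun_sub
    (h3.hasFDerivAt.comp_hasDerivAt z h1.hasDerivAt)).deriv.trans ?_
  simp

/-- If two curves have contact of order `k` at a point, so do their images under a smooth map. -/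
theorem FlatAt.comp_sub {k : ℕ} {E F : Type u} [NormedAddCommGroup E] [NormedSpace 𝕜 E]
    [NormedAddCommGroup F] [NormedSpace 𝕜 F] {g : E → F} {γ δ : 𝕜 → E} {x : 𝕜}
    (hg : ContDiffAt 𝕜 (smooth 𝕜) g (γ x)) (hγ : ContDiffAt 𝕜 (smooth 𝕜) γ x)
    (hδ : ContDiffAt 𝕜 (smooth 𝕜) δ x) (h0 : δ x = γ x) (hk : FlatAt k (fun z => δ z - γ z) x) :
    FlatAt k (fun z => g (δ z) - g (γ z)) x ∧
      iteratedDeriv k (fun z => g (δ z) - g (γ z)) x =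
        fderiv 𝕜 g (γ x) (iteratedDeriv k (fun z => δ z - γ z) x) := by
  have hs : ContDiffAt 𝕜 (smooth 𝕜) (fun z => g (δ z) - g (γ z)) x :=
    (ContDiffAt.comp x (h0 ▸ hg) hδ).sub (hg.comp x hγ)
  induction k generalizing F with
  | zero => exact ⟨⟨hs, by simp⟩, by simp [h0]⟩
  | succ k ih =>
    have hg' := fderiv_smooth hg
    have hd := deriv_comp_sub hg hγ hδ h0
    have h1 := ih hg' (hk.mono k.le_succ)
      ((ContDiffAt.comp x (h0 ▸ hg') hδ).sub (hg'.comp x hγ))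
    have h2 := FlatAt.bilin (ContinuousLinearMap.id 𝕜 (E →L[𝕜] F)).flip (deriv_smooth hδ) h1.1
    have h3 := FlatAt.bilin (ContinuousLinearMap.id 𝕜 (E →L[𝕜] F)) (hg'.comp x hγ) hk.flat_deriv
    refine ⟨flatAt_succ hs (by simp [h0]) ((h2.1.add h3.1).congr hd), ?_⟩
    rw [iteratedDeriv_succ', hd.iteratedDeriv_eq]
    refine (iteratedDeriv_fun_add_smooth k h2.1.1 h3.1.1).trans ?_
    rw [h2.2, h3.2, h1.2, hk.2 k k.lt_succ_self, iteratedDeriv_succ']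
    simp

/-- The first order at which the second derivative of `g` is visible; the vanishing of `y_ww` is
read off from it. -/
theorem FlatAt.iteratedDeriv_succ_comp_sub {k : ℕ} {E F : Type u} [NormedAddCommGroup E]
    [NormedSpace 𝕜 E] [NormedAddCommGroup F] [NormedSpace 𝕜 F] {g : E → F} {γ δ : 𝕜 → E} {x : 𝕜}
    (hg : ContDiffAt 𝕜 (smooth 𝕜) g (γ x)) (hγ : ContDiffAt 𝕜 (smooth 𝕜) γ x)
    (hδ : ContDiffAt 𝕜 (smooth 𝕜) δ x) (h0 : δ x = γ x)
    (hk : FlatAt (k + 1) (fun z => δ z - γ z) x) :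
    iteratedDeriv (k + 2) (fun z => g (δ z) - g (γ z)) x =
      fderiv 𝕜 (fderiv 𝕜 g) (γ x) (iteratedDeriv (k + 1) (fun z => δ z - γ z) x) (deriv δ x) +
      (fderiv 𝕜 g (γ x) (iteratedDeriv (k + 2) (fun z => δ z - γ z) x) +
        ((k + 1 : ℕ) : 𝕜) • fderiv 𝕜 (fderiv 𝕜 g) (γ x) (deriv γ x)
          (iteratedDeriv (k + 1) (fun z => δ z - γ z) x)) := by
  have hg' := fderiv_smooth hg
  have hd := deriv_comp_sub hg hγ hδ h0
  have h1 := FlatAt.comp_sub hg' hγ hδ h0 hk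
  have h2 := FlatAt.bilin (ContinuousLinearMap.id 𝕜 (E →L[𝕜] F)).flip (deriv_smooth hδ) h1.1
  have h3 := FlatAt.iteratedDeriv_succ_bilin (ContinuousLinearMap.id 𝕜 (E →L[𝕜] F))
    (hg'.comp x hγ) hk.flat_deriv
  have h4 := (deriv_comp_curve hg' hγ).eq_of_nhds
  rw [iteratedDeriv_succ', hd.iteratedDeriv_eq]
  refine (iteratedDeriv_fun_add_smooth (k + 1) h2.1.1
    (bilin_smooth _ (hg'.comp x hγ) hk.flat_deriv.1)).trans ?_
  rw [h2.2, h1.2]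
  refine congrArg₂ _ rfl (h3.trans ?_)
  rw [← iteratedDeriv_succ' (n := k + 1), ← iteratedDeriv_succ' (n := k)]
  simp only [Function.comp_def, h4, ContinuousLinearMap.id_apply]

end Contact

/-! ### Derivatives along parametrized curves. -/

section DerivAlong

variable {𝕜 : Type*} [NontriviallyNormedField 𝕜] {m : ℕ}

theorem derivAlong_congr {F F' : 𝕜 → 𝕜} {Y Y' : 𝕜 → Fin m → 𝕜} {x : 𝕜} (hF : F =ᶠ[𝓝 x] F')
    (hY : Y =ᶠ[𝓝 x] Y') (k : ℕ) : derivAlong F Y k =ᶠ[𝓝 x] derivAlong F' Y' k := by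
  induction k with
  | zero => exact hY
  | succ k ih =>
    filter_upwards [hF.deriv, ih.deriv] with z h1 h2
    simp only [derivAlong, h1, h2]

theorem derivAlong_smooth {F : 𝕜 → 𝕜} {Y : 𝕜 → Fin m → 𝕜} {x : 𝕜}
    (hF : ContDiffAt 𝕜 (smooth 𝕜) F x) (hF' : deriv F x ≠ 0) (hY : ContDiffAt 𝕜 (smooth 𝕜) Y x)
    (k : ℕ) : ContDiffAt 𝕜 (smooth 𝕜) (derivAlong F Y k) x := by
  induction k with
  | zero => exact hY
  | succ k ih => exact ((deriv_smooth hF).inv hF').smul (deriv_smooth ih)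

/-- The difference of the two quotients is arranged so that each term contains the derivative of a
difference, which is the flat factor for `FlatAt.bilin`. -/
theorem derivAlong_succ_sub {F F' : 𝕜 → 𝕜} {y y' : 𝕜 → Fin m → 𝕜} {x : 𝕜}
    (hF : ContDiffAt 𝕜 (smooth 𝕜) F x) (hF' : ContDiffAt 𝕜 (smooth 𝕜) F' x)
    (hy : ContDiffAt 𝕜 (smooth 𝕜) y x) (hy' : ContDiffAt 𝕜 (smooth 𝕜) y' x)
    (h : deriv F x ≠ 0) (h' : deriv F' x ≠ 0) :
    (fun z => (deriv F' z)⁻¹ • deriv y' z - (deriv F z)⁻¹ • deriv y z) =ᶠ[𝓝 x] fun z =>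
      ContinuousLinearMap.lsmul 𝕜 𝕜 (deriv F' z)⁻¹ (deriv (fun t => y' t - y t) z) +
      (ContinuousLinearMap.lsmul 𝕜 𝕜).flip (-((deriv F' z)⁻¹ * (deriv F z)⁻¹) • deriv y z)
        (deriv (fun t => F' t - F t) z) := by
  filter_upwards [eventually_differentiableAt hF, eventually_differentiableAt hF',
    eventually_differentiableAt hy, eventually_differentiableAt hy',
    (deriv_smooth hF).continuousAt.eventually_ne h,
    (deriv_smooth hF').continuousAt.eventually_ne h'] with z h1 h2 h3 h4 h5 h6
  rw [deriv_fun_sub h2 h1, deriv_fun_sub h4 h3]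
  simp only [ContinuousLinearMap.lsmul_apply, ContinuousLinearMap.flip_apply, smul_smul]
  rw [smul_sub, sub_eq_add_neg, sub_eq_add_neg, add_assoc, add_right_inj, ← neg_smul, ← neg_smul,
    ← add_smul]
  congr 1
  field_simp
  ring

/-- If two parametrized curves have contact of order `n ≥ 2`, the difference of the `k`-th
derivatives of `y` with respect to `x` vanishes to order `n - k`, with the expected leading term. -/
theorem FlatAt.derivAlong_sub {n : ℕ} {F F' : 𝕜 → 𝕜} {Y Y' : 𝕜 → Fin m → 𝕜} {x : 𝕜}
    (hn : 2 ≤ n) (hF : ContDiffAt 𝕜 (smooth 𝕜) F x) (hF' : ContDiffAt 𝕜 (smooth 𝕜) F' x)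
    (hY : ContDiffAt 𝕜 (smooth 𝕜) Y x) (hY' : ContDiffAt 𝕜 (smooth 𝕜) Y' x)
    (h : deriv F x ≠ 0) (hα : FlatAt n (fun z => F' z - F z) x)
    (hβ : FlatAt n (fun z => Y' z - Y z) x) {i j : ℕ} (hij : i + (j + 1) = n) :
    FlatAt i (fun z => derivAlong F' Y' (j + 1) z - derivAlong F Y (j + 1) z) x ∧
      iteratedDeriv i (fun z => derivAlong F' Y' (j + 1) z - derivAlong F Y (j + 1) z) x =
        (deriv F x)⁻¹ ^ (j + 1) • (iteratedDeriv n (fun z => Y' z - Y z) x -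
          iteratedDeriv n (fun z => F' z - F z) x • derivAlong F Y 1 x) := by
  -- Contact of order `n ≥ 2` includes the first derivatives.
  have hFF : deriv F' x = deriv F x := by
    have := hα.2 1 (by omega)
    rw [iteratedDeriv_one, deriv_fun_sub (eventually_differentiableAt hF').self_of_nhds
      (eventually_differentiableAt hF).self_of_nhds] at this
    exact sub_eq_zero.1 this
  have h' : deriv F' x ≠ 0 := hFF ▸ h
  obtain ⟨l, rfl⟩ : ∃ l, n = l + 1 := ⟨n - 1, by omega⟩
  have hi1 := (deriv_smooth hF').inv h'
  induction j generalizing i with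
  | zero =>
    obtain rfl : i = l := by omega
    have hd := derivAlong_succ_sub hF hF' hY hY' h h'
    have h1 := FlatAt.bilin (ContinuousLinearMap.lsmul 𝕜 𝕜) hi1 hβ.flat_deriv
    have h2 := FlatAt.bilin (ContinuousLinearMap.lsmul 𝕜 𝕜 (E := Fin m → 𝕜)).flip
      ((hi1.mul ((deriv_smooth hF).inv h)).neg.smul (deriv_smooth hY)) hα.flat_deriv
    refine ⟨(h1.1.add h2.1).congr hd, ?_⟩
    refine (hd.iteratedDeriv_eq i).trans ?_
    refine (iteratedDeriv_fun_add_smooth i h1.1.1 h2.1.1).trans ?_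
    rw [h1.2]
    refine (congrArg₂ _ rfl h2.2).trans ?_
    rw [iteratedDeriv_succ' (n := i), iteratedDeriv_succ' (n := i)]
    simp only [ContinuousLinearMap.lsmul_apply, ContinuousLinearMap.flip_apply, derivAlong, hFF,
      zero_add, pow_one, Pi.inv_apply, Pi.smul_apply']
    module
  | succ j ih =>
    have ih := ih (i := i + 1) (by omega)
    have hd := derivAlong_succ_sub hF hF' (derivAlong_smooth hF h hY (j + 1))
      (derivAlong_smooth hF' h' hY' (j + 1)) h h'
    have h1 := FlatAt.bilin (ContinuousLinearMap.lsmul 𝕜 𝕜) hi1 ih.1.flat_deriv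
    have h2 := FlatAt.bilin (ContinuousLinearMap.lsmul 𝕜 𝕜 (E := Fin m → 𝕜)).flip
      ((hi1.mul ((deriv_smooth hF).inv h)).neg.smul
        (deriv_smooth (derivAlong_smooth hF h hY (j + 1)))) (hα.flat_deriv.mono (l := i) (by omega))
    refine ⟨(h1.1.add h2.1).congr hd, ?_⟩
    refine (hd.iteratedDeriv_eq i).trans ?_
    refine (iteratedDeriv_fun_add_smooth i h1.1.1 h2.1.1).trans ?_
    rw [h1.2]
    refine (congrArg₂ _ rfl h2.2).trans ?_
    -- Here `i < l`, so the contribution of `F' - F` vanishes; it enters the leading term only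
    -- through the first differentiation.
    rw [← iteratedDeriv_succ', ih.2, hα.flat_deriv.2 i (by omega)]
    simp only [ContinuousLinearMap.lsmul_apply, map_zero, add_zero, smul_smul, Pi.inv_apply, hFF,
      pow_succ' (deriv F x)⁻¹ (j + 1)]

end DerivAlong

/-! ### Curves with a prescribed jet. -/

section Jets

variable {𝕜 : Type*} [NontriviallyNormedField 𝕜] [CharZero 𝕜]
  {E : Type*} [NormedAddCommGroup E] [NormedSpace 𝕜 E]

theorem iteratedDeriv_monomial (x : 𝕜) (v : E) (k i : ℕ) :
    iteratedDeriv i (fun z => ((z - x) ^ k / (k.factorial : 𝕜)) • v) x =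
      if i = k then v else 0 := by
  induction i generalizing k with
  | zero => cases k <;> simp
  | succ i ih =>
    cases k with
    | zero => simp [iteratedDeriv_const]
    | succ k =>
      have : deriv (fun z => ((z - x) ^ (k + 1) / ((k + 1).factorial : 𝕜)) • v) =
          fun z => ((z - x) ^ k / (k.factorial : 𝕜)) • v := by
        ext z
        have h := (((((hasDerivAt_id z).sub_const x).pow (k + 1)).div_const
          ((k + 1).factorial : 𝕜)).smul_const v).deriv
        refine Eq.trans h ?_
        congr 1
        have h1 : ((k + 1 : ℕ) : 𝕜) ≠ 0 := Nat.cast_ne_zero.2 k.succ_ne_zero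
        have h2 : (k.factorial : 𝕜) ≠ 0 := Nat.cast_ne_zero.2 k.factorial_ne_zero
        rw [Nat.factorial_succ, Nat.cast_mul]
        simp only [id, Nat.add_sub_cancel, mul_one]
        field_simp
      rw [iteratedDeriv_succ', this, ih]
      simp

/-- Every jet is the jet of a smooth curve. -/
theorem exists_curve_of_jet (n : ℕ) (j : ℕ → E) (x : 𝕜) :
    ∃ w : 𝕜 → E, ContDiffAt 𝕜 (smooth 𝕜) w x ∧ ∀ k ≤ n, iteratedDeriv k w x = j k := by
  have hs : ∀ k, ContDiffAt 𝕜 (smooth 𝕜) (fun z => ((z - x) ^ k / (k.factorial : 𝕜)) • j k) x :=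
    fun k => (((contDiffAt_id.sub contDiffAt_const).pow k).div_const _).smul contDiffAt_const
  refine ⟨fun z => ∑ k ∈ Finset.range (n + 1), ((z - x) ^ k / (k.factorial : 𝕜)) • j k,
    ContDiffAt.sum fun k _ => hs k, fun i hi => ?_⟩
  rw [iteratedDeriv_fun_sum fun k _ => (hs k).of_le (natCast_le_smooth i)]
  simp only [iteratedDeriv_monomial]
  rw [Finset.sum_ite_eq, if_pos (by simpa using Nat.lt_succ_of_le hi)]

end Jets

/-! ### Vanishing derivative implies locally constant, over any complete field of characteristic
zero. -/

section LocallyConstant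

variable {𝕜 : Type*} [NontriviallyNormedField 𝕜] [CharZero 𝕜]
  {E₁ E F : Type*} [NormedAddCommGroup E₁] [NormedSpace 𝕜 E₁] [NormedAddCommGroup E]
  [NormedSpace 𝕜 E] [NormedAddCommGroup F] [NormedSpace 𝕜 F] [CompleteSpace F]

/-- In characteristic zero, differentiation lowers the order of vanishing of `f - f x` by exactly
one, so infinite order of the derivative forces infinite order of `f - f x`. -/
theorem eventually_eq_of_deriv_eq_zero_of_analyticAt {f : 𝕜 → F} {x : 𝕜} (hf : AnalyticAt 𝕜 f x)
    (h : ∀ᶠ z in 𝓝 x, deriv f z = 0) : ∀ᶠ z in 𝓝 x, f z = f x := by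
  have h1 := hf.analyticOrderAt_deriv_add_one
  rw [analyticOrderAt_eq_top.2 h, top_add, eq_comm, analyticOrderAt_eq_top] at h1
  exact h1.mono fun z hz => sub_eq_zero.1 hz

/-- The one-variable result on the line from `(q.1, p.2)` towards `q` holds only near its start, and
there may be no connectedness to continue along the line. Instead it kills the higher terms of the
power series in that direction, and the series converges as far as `q`. -/
theorem eventually_eq_of_fderiv_snd_eq_zero_of_analyticAt {g : E₁ × E → F} {p : E₁ × E}
    (hg : AnalyticAt 𝕜 g p) (h : ∀ᶠ q in 𝓝 p, ∀ v, fderiv 𝕜 g q (0, v) = 0) :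
    ∀ᶠ q in 𝓝 p, g q = g (q.1, p.2) := by
  obtain ⟨P, r, hP⟩ := hg
  obtain ⟨s, hs, hsub⟩ := EMetric.mem_nhds_iff.1 h
  have hP := hP.mono (lt_min hP.r_pos hs) (min_le_left _ _)
  set ρ := min r s
  have hρ : 0 < ρ := hP.r_pos
  have hz : ∀ q ∈ Metric.eball p ρ, ∀ v, fderiv 𝕜 g q (0, v) = 0 := fun q hq =>
    hsub (Metric.eball_subset_eball (min_le_right _ _) hq)
  -- With half the radius, the series recentred at `q₀` still converges at `u`: both `q₀ - p` and
  -- `u` have norm below `ρ / 2`.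
  filter_upwards [Metric.eball_mem_nhds p (ENNReal.half_pos hρ.ne')] with q hq
  set q₀ : E₁ × E := (q.1, p.2)
  set u : E₁ × E := (0, q.2 - p.2)
  have hu : q₀ + u = q := by simp [q₀, u]
  have hq' : ‖q - p‖ₑ < ρ / 2 := by simpa [edist_eq_enorm_sub] using hq
  have hq₀ : ‖q₀ - p‖ₑ < ρ / 2 := by
    refine lt_of_le_of_lt ?_ hq'
    rw [enorm_le_iff_norm_le]
    simp [q₀, Prod.norm_def]
  have hu' : ‖u‖ₑ < ρ / 2 := by
    refine lt_of_le_of_lt ?_ hq'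
    rw [enorm_le_iff_norm_le]
    simp [u, Prod.norm_def]
  have hq₀ρ : ‖q₀ - p‖ₑ < ρ := hq₀.trans_le ENNReal.half_le_self
  have hQ := hP.changeOrigin (y := q₀ - p) hq₀ρ
  rw [add_sub_cancel] at hQ
  set Q := P.changeOrigin (q₀ - p)
  let L : 𝕜 →L[𝕜] E₁ × E := ContinuousLinearMap.toSpanSingleton 𝕜 u
  have hL : HasFPowerSeriesAt (fun t => g (q₀ + L t)) (Q.compContinuousLinearMap L) 0 := by
    have h0 : HasFPowerSeriesAt (fun v => g (q₀ + v)) Q (L 0) := by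
      rw [map_zero]
      exact ⟨_, hQ.r_le, hQ.r_pos, fun hy => by simpa using hQ.hasSum hy⟩
    exact h0.compContinuousLinearMap
  have hc : ∀ᶠ t in 𝓝 (0 : 𝕜), g (q₀ + L t) = g q₀ := by
    have h0 := eventually_eq_of_deriv_eq_zero_of_analyticAt hL.analyticAt ?_
    · simpa using h0
    · have hcont : ContinuousAt (fun t => q₀ + L t) 0 := by fun_prop
      have hmem : Metric.eball p ρ ∈ 𝓝 (q₀ + L 0) := by
        rw [map_zero, add_zero]
        exact Metric.isOpen_eball.mem_nhds (by simpa [edist_eq_enorm_sub] using hq₀ρ)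
      filter_upwards [hcont hmem] with t ht
      have hd : DifferentiableAt 𝕜 g (q₀ + L t) :=
        (hP.analyticAt_of_mem ht).differentiableAt
      have := hd.hasFDerivAt.comp_hasDerivAt t (L.hasDerivAt.const_add q₀)
      refine this.deriv.trans ?_
      simpa [L, u] using hz _ ht (q.2 - p.2)
  have hQ0 : ∀ k ≠ 0, Q k (fun _ => u) = 0 := by
    intro k hk
    have h1 : Q.compContinuousLinearMap L = constFormalMultilinearSeries 𝕜 𝕜 (g q₀) :=
      (hL.congr hc).eq_formalMultilinearSeries hasFPowerSeriesAt_const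
    have h2 := congrArg (fun R => R k fun _ => (1 : 𝕜)) h1
    rw [constFormalMultilinearSeries_apply_of_nonzero hk] at h2
    simpa only [FormalMultilinearSeries.compContinuousLinearMap_apply, L, Function.comp_def,
      ContinuousLinearMap.toSpanSingleton_apply, one_smul, zero_apply]
      using h2
  have hsum := hQ.hasSum (y := u) (by
    simp only [Metric.mem_eball, edist_zero_right]
    refine lt_tsub_iff_left.2 ?_
    calc _ < ρ / 2 + ρ / 2 := ENNReal.add_lt_add hq₀ hu'
      _ = ρ := ENNReal.add_halves ρ)
  rw [hu] at hsum
  rw [hsum.unique (hasSum_single 0 hQ0)]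
  have h0 := hQ.coeff_zero (fun _ => u)
  exact h0

/-- Over `ℝ` and `ℂ` the slices of a ball are convex, so a zero derivative suffices; over other
fields smooth means analytic. -/
theorem eventually_eq_of_fderiv_snd_eq_zero {g : E₁ × E → F} {p : E₁ × E}
    (hg : ContDiffAt 𝕜 (smooth 𝕜) g p) (h : ∀ᶠ q in 𝓝 p, ∀ v, fderiv 𝕜 g q (0, v) = 0) :
    ∀ᶠ q in 𝓝 p, g q = g (q.1, p.2) := by
  by_cases hk : IsRCLikeNormedField 𝕜
  · let := IsRCLikeNormedField.rclike 𝕜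
    let : NormedSpace ℝ E := .restrictScalars ℝ 𝕜 E
    obtain ⟨r, hr, hsub⟩ := Metric.mem_nhds_iff.1 (h.and (eventually_differentiableAt hg))
    filter_upwards [Metric.ball_mem_nhds p hr] with q hq
    rw [← Prod.eta p, ← ball_prod_same] at hq
    have hd : ∀ w ∈ Metric.ball p.2 r, HasFDerivAt (fun w => g (q.1, w)) (0 : E →L[𝕜] F) w := by
      intro w hw
      have hqw : (q.1, w) ∈ Metric.ball p r := by
        rw [← Prod.eta p, ← ball_prod_same]; exact ⟨hq.1, hw⟩
      have := (hsub hqw).2.hasFDerivAt.comp w (hasFDerivAt_prodMk_right q.1 w)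
      convert! this using 1
      ext v
      simpa using ((hsub hqw).1 v).symm
    exact (convex_ball p.2 r).is_const_of_fderivWithin_eq_zero (𝕜 := 𝕜) (f := fun w => g (q.1, w))
      (fun w hw => (hd w hw).differentiableAt.differentiableWithinAt)
      (fun w hw => by rw [fderivWithin_of_isOpen Metric.isOpen_ball hw]; exact (hd w hw).fderiv)
      hq.2 (Metric.mem_ball_self hr)
  · have : smooth 𝕜 = ω := by simp [smooth, minSmoothness, hk]
    rw [this] at hg
    exact eventually_eq_of_fderiv_snd_eq_zero_of_analyticAt hg.analyticAt h

theorem eventually_eq_of_deriv_eq_zero {f : 𝕜 → F} {x : 𝕜} (hf : ContDiffAt 𝕜 (smooth 𝕜) f x)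
    (h : ∀ᶠ z in 𝓝 x, deriv f z = 0) : ∀ᶠ z in 𝓝 x, f z = f x := by
  have h2 : Filter.Tendsto Prod.snd (𝓝 ((0 : 𝕜), x)) (𝓝 x) := continuous_snd.continuousAt
  have := eventually_eq_of_fderiv_snd_eq_zero (g := fun q : 𝕜 × 𝕜 => f q.2) (p := (0, x))
    (ContDiffAt.comp (g := f) ((0 : 𝕜), x) hf contDiffAt_snd) ?_
  · exact ((Continuous.prodMk_right (0 : 𝕜)).continuousAt (x := x)).eventually this
  · filter_upwards [h2.eventually h, h2.eventually (eventually_differentiableAt hf)] with q h3 h4 v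
    have := h4.hasFDerivAt.comp q hasFDerivAt_snd
    rw [show fderiv 𝕜 (fun q : 𝕜 × 𝕜 => f q.2) q = _ from this.fderiv]
    simp [fderiv_eq_smul_deriv, h3]

end LocallyConstant

/-! ### The substitution `x = f(z)`, `y = T(z) w`. -/

section LinearSubstitution

variable {𝕜 : Type*} [NontriviallyNormedField 𝕜] {m : ℕ}

/-- The coefficient of the `j`-th derivative of `w` in the `k`-th derivative of `y = T(z) w` with
respect to `x = f(z)`. -/
noncomputable def linCoeff (f : 𝕜 → 𝕜) (T : 𝕜 → (Fin m → 𝕜) →L[𝕜] (Fin m → 𝕜)) :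
    ℕ → ℕ → 𝕜 → (Fin m → 𝕜) →L[𝕜] (Fin m → 𝕜)
  | 0, 0 => T
  | 0, _ + 1 => fun _ => 0
  | k + 1, 0 => fun z => (deriv f z)⁻¹ • deriv (linCoeff f T k 0) z
  | k + 1, j + 1 => fun z =>
      (deriv f z)⁻¹ • (deriv (linCoeff f T k (j + 1)) z + linCoeff f T k j z)

variable {f : 𝕜 → 𝕜} {T : 𝕜 → (Fin m → 𝕜) →L[𝕜] (Fin m → 𝕜)} {x : 𝕜}

theorem linCoeff_of_lt {k j : ℕ} (h : k < j) : linCoeff f T k j = fun _ => 0 := by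
  induction k generalizing j with
  | zero =>
    obtain ⟨j, rfl⟩ : ∃ l, j = l + 1 := ⟨j - 1, by omega⟩
    rfl
  | succ k ih =>
    obtain ⟨j, rfl⟩ : ∃ l, j = l + 1 := ⟨j - 1, by omega⟩
    ext1 z
    simp only [linCoeff, ih (show k < j by omega), ih (show k < j + 1 by omega), deriv_const,
      add_zero]
    exact smul_zero (A := (Fin m → 𝕜) →L[𝕜] (Fin m → 𝕜)) (deriv f z)⁻¹

theorem linCoeff_self (k : ℕ) : linCoeff f T k k = fun z => (deriv f z)⁻¹ ^ k • T z := by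
  induction k with
  | zero => simp [linCoeff]
  | succ k ih =>
    ext1 z
    simp only [linCoeff, ih, linCoeff_of_lt (Nat.lt_succ_self k)]
    simp [smul_smul, pow_succ']

theorem linCoeff_smooth (hf : ContDiffAt 𝕜 (smooth 𝕜) f x) (hf' : deriv f x ≠ 0)
    (hT : ContDiffAt 𝕜 (smooth 𝕜) T x) (k j : ℕ) :
    ContDiffAt 𝕜 (smooth 𝕜) (linCoeff f T k j) x := by
  induction k generalizing j with
  | zero =>
    cases j with
    | zero => exact hT
    | succ j => exact contDiffAt_const
  | succ k ih =>
    have h := (deriv_smooth hf).inv hf'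
    cases j with
    | zero => exact h.smul (deriv_smooth (ih 0))
    | succ j => exact h.smul ((deriv_smooth (ih (j + 1))).add (ih j))

/-- The `i`-th differentiation, `0 ≤ i ≤ k`, differentiates `f'^(-i) T` and contributes `T' - i
(f''/f') T` up to the common power of `f'`; the sum of the `i` is `k (k + 1) / 2`. -/
theorem linCoeff_succ_self [CharZero 𝕜] (hf : ContDiffAt 𝕜 (smooth 𝕜) f x) (hf' : deriv f x ≠ 0)
    (hT : ContDiffAt 𝕜 (smooth 𝕜) T x) (k : ℕ) :
    linCoeff f T (k + 1) k =ᶠ[𝓝 x] fun z => ((k + 1 : 𝕜) * (deriv f z)⁻¹ ^ (k + 1)) •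
      (deriv T z - ((k : 𝕜) / 2 * (deriv (deriv f) z / deriv f z)) • T z) := by
  induction k with
  | zero =>
    refine Filter.Eventually.of_forall fun z => ?_
    · simp only [linCoeff, Nat.cast_zero, zero_div, zero_mul, zero_add, pow_one, one_mul]
      exact congrArg _ (sub_eq_self.2 (zero_smul 𝕜 (T z))).symm
  | succ k ih =>
    filter_upwards [ih, eventually_differentiableAt hT,
      eventually_differentiableAt (deriv_smooth hf),
      (deriv_smooth hf).continuousAt.eventually_ne hf'] with z h1 h2 h3 h4
    have hd : deriv (linCoeff f T (k + 1) (k + 1)) z =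
        (deriv f z)⁻¹ ^ (k + 1) • deriv T z +
        ((k + 1 : 𝕜) * (deriv f z)⁻¹ ^ k * (-deriv (deriv f) z / deriv f z ^ 2)) • T z := by
      rw [linCoeff_self]
      refine (((h3.hasDerivAt.fun_inv h4).fun_pow (k + 1)).fun_smul h2.hasDerivAt).deriv.trans ?_
      push_cast
      simp
    change (deriv f z)⁻¹ • (deriv (linCoeff f T (k + 1) (k + 1)) z + linCoeff f T (k + 1) k z) = _
    rw [hd, h1, smul_add, smul_add, smul_smul, smul_smul, smul_smul, smul_sub, smul_sub, smul_smul,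
      smul_smul]
    have h2' : (2 : 𝕜) ≠ 0 := two_ne_zero
    push_cast
    simp only [inv_pow]
    match_scalars <;> field_simp <;> ring

theorem derivAlong_linear (hf : ContDiffAt 𝕜 (smooth 𝕜) f x) (hf' : deriv f x ≠ 0)
    (hT : ContDiffAt 𝕜 (smooth 𝕜) T x) {w : 𝕜 → Fin m → 𝕜} (hw : ContDiffAt 𝕜 (smooth 𝕜) w x)
    (k : ℕ) : derivAlong f (fun z => T z (w z)) k =ᶠ[𝓝 x] fun z =>
      ∑ j ∈ Finset.range (k + 1), linCoeff f T k j z (iteratedDeriv j w z) := by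
  induction k with
  | zero => exact Filter.Eventually.of_forall fun z => by simp [linCoeff, derivAlong]
  | succ k ih =>
    have hA : ∀ᶠ z in 𝓝 x, ∀ j ∈ Finset.range (k + 1), DifferentiableAt 𝕜 (linCoeff f T k j) z :=
      (Finset.eventually_all _).2 fun j _ =>
        eventually_differentiableAt (linCoeff_smooth hf hf' hT k j)
    have hW : ∀ᶠ z in 𝓝 x, ∀ j ∈ Finset.range (k + 1), DifferentiableAt 𝕜 (iteratedDeriv j w) z :=
      (Finset.eventually_all _).2 fun j _ => eventually_differentiableAt (iteratedDeriv_smooth hw j)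
    filter_upwards [ih.deriv, hA, hW] with z h1 h2 h3
    have hd := (HasDerivAt.fun_sum fun j hj =>
      (h2 j hj).hasDerivAt.clm_apply (h3 j hj).hasDerivAt).deriv
    simp only [derivAlong]
    rw [h1, hd, Finset.sum_range_succ' _ (k + 1), Finset.sum_add_distrib,
      Finset.sum_range_succ' _ k]
    simp only [linCoeff, smul_apply, add_apply, ← iteratedDeriv_succ]
    rw [← Finset.smul_sum, ← smul_add, Finset.sum_add_distrib]
    congr 1
    rw [Finset.sum_range_succ (fun j => (deriv (linCoeff f T k (j + 1)) z)
      (iteratedDeriv (j + 1) w z)) k]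
    rw [linCoeff_of_lt (Nat.lt_succ_self k)]
    simp only [deriv_const, zero_apply, add_zero]
    abel

end LinearSubstitution

/-! ### Matrices and continuous linear maps. -/

section MatrixMaps

variable {𝕜 : Type*} [NontriviallyNormedField 𝕜] [CompleteSpace 𝕜] {m : ℕ}

/-- Matrices as continuous linear maps. -/
noncomputable def matCLM (𝕜 : Type*) [NontriviallyNormedField 𝕜] [CompleteSpace 𝕜] (m : ℕ) :
    Matrix (Fin m) (Fin m) 𝕜 ≃ₗ[𝕜] ((Fin m → 𝕜) →L[𝕜] (Fin m → 𝕜)) :=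
  Matrix.toLin'.trans LinearMap.toContinuousLinearMap

@[simp]
theorem matCLM_apply (M : Matrix (Fin m) (Fin m) 𝕜) (v : Fin m → 𝕜) :
    matCLM 𝕜 m M v = M *ᵥ v := by
  simp [matCLM]

theorem matCLM_mul (M N : Matrix (Fin m) (Fin m) 𝕜) :
    matCLM 𝕜 m (M * N) = matCLM 𝕜 m M * matCLM 𝕜 m N := by
  ext1 v
  simp

theorem matCLM_one : matCLM 𝕜 m 1 = 1 := by
  ext1 v
  simp

theorem isUnit_matCLM_iff {M : Matrix (Fin m) (Fin m) 𝕜} : IsUnit (matCLM 𝕜 m M) ↔ IsUnit M := by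
  constructor
  · rintro ⟨u, hu⟩
    have h := u.mul_inv
    rw [hu, ← (matCLM 𝕜 m).apply_symm_apply (↑u⁻¹), ← matCLM_mul, ← matCLM_one] at h
    exact .of_mul_eq_one _ ((matCLM 𝕜 m).injective h)
  · rintro ⟨u, rfl⟩
    refine ⟨⟨matCLM 𝕜 m u, matCLM 𝕜 m ↑u⁻¹, ?_, ?_⟩, rfl⟩
    · rw [← matCLM_mul, u.mul_inv, matCLM_one]
    · rw [← matCLM_mul, u.inv_mul, matCLM_one]

theorem contDiffAt_matCLM_iff {T : 𝕜 → Matrix (Fin m) (Fin m) 𝕜} {x : 𝕜} {N : WithTop ℕ∞} :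
    ContDiffAt 𝕜 N (fun z => matCLM 𝕜 m (T z)) x ↔
      ∀ i j, ContDiffAt 𝕜 N (fun z => T z i j) x := by
  constructor
  · intro h i j
    have h1 := contDiffAt_pi.1 (h.clm_apply (contDiffAt_const (c := Pi.single j (1 : 𝕜)))) i
    simpa using h1
  · intro h
    let L : (Fin m → Fin m → 𝕜) →L[𝕜] ((Fin m → 𝕜) →L[𝕜] (Fin m → 𝕜)) :=
      LinearMap.toContinuousLinearMap (matCLM 𝕜 m).toLinearMap
    exact L.contDiff.contDiffAt.comp x (contDiffAt_pi.2 fun i => contDiffAt_pi.2 fun j => h i j)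

end MatrixMaps

/-! ### Transformation of the coefficients under a local form. -/

section LocalForm

variable {𝕜 : Type*} [NontriviallyNormedField 𝕜] {m : ℕ}

/-- Near the point `p` the transformation `e` reads `x = f(z)`, `y = T(z) w`, with the values of
`T` written as linear maps. -/
def LocalForm (e : OpenPartialHomeomorph (𝕜 × (Fin m → 𝕜)) (𝕜 × (Fin m → 𝕜))) (f : 𝕜 → 𝕜)
    (T : 𝕜 → (Fin m → 𝕜) →L[𝕜] (Fin m → 𝕜)) (p : 𝕜 × (Fin m → 𝕜)) : Prop :=
  (∀ᶠ q in 𝓝 p, e q = (f q.1, T q.1 q.2)) ∧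
    ∀ᶠ z in 𝓝 p.1, ContDiffAt 𝕜 (smooth 𝕜) f z ∧ deriv f z ≠ 0 ∧
      ContDiffAt 𝕜 (smooth 𝕜) T z ∧ IsUnit (T z)

variable {e : OpenPartialHomeomorph (𝕜 × (Fin m → 𝕜)) (𝕜 × (Fin m → 𝕜))} {f : 𝕜 → 𝕜}
  {T : 𝕜 → (Fin m → 𝕜) →L[𝕜] (Fin m → 𝕜)} {p : 𝕜 × (Fin m → 𝕜)}

theorem eventually_fst {P : 𝕜 → Prop} (h : ∀ᶠ z in 𝓝 p.1, P z) : ∀ᶠ q in 𝓝 p, P q.1 :=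
  continuousAt_fst.eventually h

theorem LocalForm.eventually_curve (h : LocalForm e f T p) :
    ∀ᶠ q in 𝓝 p, ∀ w : 𝕜 → Fin m → 𝕜, ContDiffAt 𝕜 (smooth 𝕜) w q.1 → w q.1 = q.2 →
      ((fun z => (e (z, w z)).1) =ᶠ[𝓝 q.1] f) ∧
      ((fun z => (e (z, w z)).2) =ᶠ[𝓝 q.1] fun z => T z (w z)) := by
  filter_upwards [h.1.eventually_nhds] with q hq w hw hwq
  have hc : ContinuousAt (fun z => (z, w z)) q.1 := continuousAt_id.prodMk hw.continuousAt
  have hq' : ∀ᶠ r in 𝓝 (q.1, w q.1), e r = (f r.1, T r.1 r.2) := by rwa [hwq]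
  have := hc.eventually hq'
  exact ⟨this.mono fun z hz => congrArg Prod.fst hz, this.mono fun z hz => congrArg Prod.snd hz⟩

theorem LocalForm.derivAlong_eq (h : LocalForm e f T p) :
    ∀ᶠ q in 𝓝 p, ∀ w : 𝕜 → Fin m → 𝕜, ContDiffAt 𝕜 (smooth 𝕜) w q.1 → w q.1 = q.2 →
      deriv (fun z => (e (z, w z)).1) q.1 ≠ 0 ∧
      ∀ k, derivAlong (fun z => (e (z, w z)).1) (fun z => (e (z, w z)).2) k q.1 =
        ∑ j ∈ Finset.range (k + 1), linCoeff f T k j q.1 (iteratedDeriv j w q.1) := by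
  filter_upwards [h.eventually_curve, eventually_fst h.2] with q hq hz w hw hwq
  obtain ⟨h1, h2⟩ := hq w hw hwq
  refine ⟨by rw [h1.deriv_eq]; exact hz.2.1, fun k => ?_⟩
  rw [(derivAlong_congr h1 h2 k).eq_of_nhds,
    (derivAlong_linear hz.1 hz.2.1 hz.2.2.1 hw k).eq_of_nhds]

theorem sum_Icc_sub {M : Type*} [AddCommMonoid M] (n : ℕ) (φ : ℕ → M) :
    ∑ k ∈ Finset.Icc 1 n, φ (n - k) = ∑ j ∈ Finset.range n, φ j := by
  refine Finset.sum_nbij' (fun k => n - k) (fun j => n - j) ?_ ?_ ?_ ?_ ?_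
  all_goals intro a ha; simp at ha ⊢; try omega

/-- When `H 1 = 0`, the derivative of order `n - 1` of a solution does not affect the one of order
`n`. So `u = w^(n-1)` can vary alone, while the image must keep `y^(n) = 0`; its coefficient there
is therefore zero. -/
theorem LocalForm.linCoeff_pred_eq_zero [CharZero 𝕜] (h : LocalForm e f T p) {n : ℕ} (hn : 2 ≤ n)
    {H : Coeffs 𝕜 m} (hH : ∀ᶠ z in 𝓝 p.1, H 1 z = 0)
    (ht : ∀ᶠ q in 𝓝 p, TransformsAt n e (fun _ _ => 0) H q) :
    ∀ᶠ z in 𝓝 p.1, linCoeff f T n (n - 1) z = 0 := by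
  have hc : Filter.Tendsto (fun z => (z, p.2)) (𝓝 p.1) (𝓝 p) :=
    (Continuous.prodMk_left p.2).tendsto p.1
  filter_upwards [hH, hc.eventually ht, hc.eventually h.derivAlong_eq] with z h1 h2 h3
  have h4 : ∀ u, linCoeff f T n n z (-(H n z *ᵥ p.2)) + linCoeff f T n (n - 1) z u +
      linCoeff f T n 0 z p.2 = 0 := by
    intro u
    obtain ⟨w, hw, hj⟩ := exists_curve_of_jet (𝕜 := 𝕜) n (fun k => if k = 0 then p.2 else
      if k = n - 1 then u else if k = n then -(H n z *ᵥ p.2) else 0) z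
    have hwz : w z = p.2 := by simpa using hj 0 (Nat.zero_le n)
    obtain ⟨h5, h6⟩ := h3 w hw hwz
    have h7 := (h2 w hw hwz h5).2 ?_
    · simp only [HoldsAt, Matrix.zero_mulVec, Finset.sum_const_zero, add_zero, h6] at h7
      obtain ⟨l, rfl⟩ : ∃ l, n = l + 2 := ⟨n - 2, by omega⟩
      rw [Finset.sum_range_succ, Finset.sum_range_succ, Finset.sum_range_succ', hj (l + 2) le_rfl,
        hj (l + 1) (by omega), hj 0 (by omega), Finset.sum_eq_zero] at h7
      · simp at h7 ⊢
        rw [← h7]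
        abel
      · intro i hi
        have := Finset.mem_range.1 hi
        rw [hj (i + 1) (by omega), if_neg (by omega), if_neg (by omega), if_neg (by omega),
          map_zero]
    · simp only [HoldsAt]
      rw [hj n le_rfl, if_neg (by omega), if_neg (by omega), if_pos rfl,
        Finset.sum_eq_single_of_mem n (by simp; omega)]
      · rw [Nat.sub_self, hj 0 (Nat.zero_le n), if_pos rfl, neg_add_cancel]
      · intro k hk hkn
        have := Finset.mem_Icc.1 hk
        rcases eq_or_ne k 1 with rfl | hk1
        · rw [h1, Matrix.zero_mulVec]
        · rw [hj (n - k) (by omega), if_neg (by omega), if_neg (by omega), if_neg (by omega),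
            Matrix.mulVec_zero]
  ext1 u
  have h5 := h4 u
  -- Comparison with `u = 0` cancels the terms independent of `u`.
  rw [← h4 0, map_zero] at h5
  simpa using h5

theorem clm_mul_apply (A B : (Fin m → 𝕜) →L[𝕜] (Fin m → 𝕜)) (v : Fin m → 𝕜) :
    (A * B) v = A (B v) := rfl

theorem isUnit_smul_clm {c : 𝕜} (hc : c ≠ 0) {A : (Fin m → 𝕜) →L[𝕜] (Fin m → 𝕜)}
    (hA : IsUnit A) : IsUnit (c • A) := by
  obtain ⟨u, rfl⟩ := hA
  refine ⟨⟨c • u, c⁻¹ • ↑u⁻¹, ?_, ?_⟩, rfl⟩ <;> ext1 v <;>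
    simp only [clm_mul_apply, smul_apply, map_smul]
  · rw [smul_smul, inv_mul_cancel₀ hc, one_smul, ← clm_mul_apply, u.mul_inv]
  · rw [smul_smul, mul_inv_cancel₀ hc, one_smul, ← clm_mul_apply, u.inv_mul]

variable [CompleteSpace 𝕜]

/-- The coefficient of the `j`-th derivative of `w` in the system with coefficients `B` after the
substitution `x = f(z)`, `y = T(z) w`. -/
noncomputable def pullCoeff (n : ℕ) (f : 𝕜 → 𝕜) (T : 𝕜 → (Fin m → 𝕜) →L[𝕜] (Fin m → 𝕜))
    (B : Coeffs 𝕜 m) (j : ℕ) (z : 𝕜) : (Fin m → 𝕜) →L[𝕜] (Fin m → 𝕜) :=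
  linCoeff f T n j z + ∑ k ∈ Finset.Icc 1 n, matCLM 𝕜 m (B k (f z)) * linCoeff f T (n - k) j z

theorem pullCoeff_self (n : ℕ) (B : Coeffs 𝕜 m) (z : 𝕜) :
    pullCoeff n f T B n z = (deriv f z)⁻¹ ^ n • T z := by
  rw [pullCoeff, linCoeff_self, Finset.sum_eq_zero, add_zero]
  intro k hk
  have hk' := Finset.mem_Icc.1 hk
  rw [linCoeff_of_lt (show n - k < n by omega), mul_zero]

theorem pullCoeff_pred {n : ℕ} (hn : 2 ≤ n) (B : Coeffs 𝕜 m) {z : 𝕜} (hB : B 1 (f z) = 0) :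
    pullCoeff n f T B (n - 1) z = linCoeff f T n (n - 1) z := by
  rw [pullCoeff, Finset.sum_eq_zero, add_zero]
  intro k hk
  have hk' := Finset.mem_Icc.1 hk
  rcases eq_or_ne k 1 with rfl | hk1
  · rw [hB, map_zero, zero_mul]
  · rw [linCoeff_of_lt (show n - k < n - 1 by omega), mul_zero]

theorem holdsAt_linear_iff (n : ℕ) (B : Coeffs 𝕜 m) (z : 𝕜) (j : ℕ → Fin m → 𝕜) :
    HoldsAt n B (f z) (fun k => ∑ i ∈ Finset.range (k + 1), linCoeff f T k i z (j i)) ↔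
      ∑ i ∈ Finset.range (n + 1), pullCoeff n f T B i z (j i) = 0 := by
  unfold HoldsAt
  have h1 : ∀ k ≤ n, ∑ i ∈ Finset.range (k + 1), linCoeff f T k i z (j i) =
      ∑ i ∈ Finset.range (n + 1), linCoeff f T k i z (j i) := by
    intro k hk
    refine Finset.sum_subset (Finset.range_subset_range.2 (by omega)) fun i _ hi => ?_
    rw [linCoeff_of_lt (by simpa using hi), zero_apply]
  have h2 : ∑ k ∈ Finset.Icc 1 n, B k (f z) *ᵥ
        (∑ i ∈ Finset.range (n - k + 1), linCoeff f T (n - k) i z (j i)) =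
      ∑ i ∈ Finset.range (n + 1), ∑ k ∈ Finset.Icc 1 n,
        (matCLM 𝕜 m (B k (f z)) * linCoeff f T (n - k) i z) (j i) := by
    rw [Finset.sum_comm]
    refine Finset.sum_congr rfl fun k _ => ?_
    rw [h1 (n - k) (Nat.sub_le _ _), ← matCLM_apply, map_sum]
    rfl
  rw [h2, ← Finset.sum_add_distrib]
  refine Eq.congr (Finset.sum_congr rfl fun i _ => ?_) rfl
  simp only [pullCoeff, add_apply, sum_apply]

/-- The coefficients of the system obtained from `B` by the substitution `x = f(z)`,
`y = T(z) w`. -/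
noncomputable def pullback (n : ℕ) (f : 𝕜 → 𝕜) (T : 𝕜 → (Fin m → 𝕜) →L[𝕜] (Fin m → 𝕜))
    (B : Coeffs 𝕜 m) : Coeffs 𝕜 m := fun k z =>
  (matCLM 𝕜 m).symm (Ring.inverse (pullCoeff n f T B n z) * pullCoeff n f T B (n - k) z)

theorem isUnit_pullCoeff_self (n : ℕ) (B : Coeffs 𝕜 m) {z : 𝕜} (hf' : deriv f z ≠ 0)
    (hT : IsUnit (T z)) : IsUnit (pullCoeff n f T B n z) := by
  rw [pullCoeff_self]
  exact isUnit_smul_clm (pow_ne_zero n (inv_ne_zero hf')) hT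

/-- Division by the invertible leading coefficient does not change the solutions. -/
theorem holdsAt_pullback_iff (n : ℕ) (B : Coeffs 𝕜 m) {z : 𝕜} (hf' : deriv f z ≠ 0)
    (hT : IsUnit (T z)) (j : ℕ → Fin m → 𝕜) :
    HoldsAt n (pullback n f T B) z j ↔
      ∑ i ∈ Finset.range (n + 1), pullCoeff n f T B i z (j i) = 0 := by
  have hu := isUnit_pullCoeff_self n B hf' hT
  obtain ⟨u, hu'⟩ := hu
  have key : ∑ i ∈ Finset.range (n + 1), pullCoeff n f T B i z (j i) =
      (u : (Fin m → 𝕜) →L[𝕜] (Fin m → 𝕜)) (j n + ∑ k ∈ Finset.Icc 1 n,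
        pullback n f T B k z *ᵥ j (n - k)) := by
    rw [Finset.sum_range_succ, ← sum_Icc_sub, map_add, map_sum, add_comm, hu']
    congr 1
    refine Finset.sum_congr rfl fun k _ => ?_
    rw [pullback, ← matCLM_apply, LinearEquiv.apply_symm_apply, ← hu', Ring.inverse_unit,
      ← clm_mul_apply, ← mul_assoc, u.mul_inv, one_mul]
  rw [key, HoldsAt]
  constructor
  · intro h; rw [h, map_zero]
  · intro h
    have h2 := congrArg (fun v => (↑u⁻¹ : (Fin m → 𝕜) →L[𝕜] (Fin m → 𝕜)) v) h
    simp only [map_zero] at h2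
    rwa [← clm_mul_apply, u.inv_mul, one_apply_eq_self] at h2

theorem pullCoeff_smooth (n : ℕ) {B : Coeffs 𝕜 m} {z : 𝕜} (hf : ContDiffAt 𝕜 (smooth 𝕜) f z)
    (hf' : deriv f z ≠ 0) (hT : ContDiffAt 𝕜 (smooth 𝕜) T z)
    (hB : ∀ k ∈ Finset.Icc 1 n, ∀ i j, ContDiffAt 𝕜 (smooth 𝕜) (fun t => B k t i j) (f z)) (j : ℕ) :
    ContDiffAt 𝕜 (smooth 𝕜) (pullCoeff n f T B j) z := by
  refine (linCoeff_smooth hf hf' hT n j).add (ContDiffAt.sum fun k hk => ?_)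
  exact (contDiffAt_matCLM_iff.2 fun i l => (hB k hk i l).comp z hf).mul
    (linCoeff_smooth hf hf' hT (n - k) j)

theorem LocalForm.transformsAt (h : LocalForm e f T p) (n : ℕ) (B : Coeffs 𝕜 m) :
    ∀ᶠ q in 𝓝 p, TransformsAt n e B (pullback n f T B) q := by
  filter_upwards [h.derivAlong_eq, h.1, eventually_fst h.2] with q h1 h2 h3 w hw hwq _
  rw [holdsAt_pullback_iff n B h3.2.1 h3.2.2.2, ← holdsAt_linear_iff, h2]
  simp only [(h1 w hw hwq).2]

theorem LocalForm.generalFamily (h : LocalForm e f T p) {n : ℕ} {B : Coeffs 𝕜 m}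
    (hB : GeneralFamily n B (e p).1) : GeneralFamily n (pullback n f T B) p.1 := by
  have hc := h.2.self_of_nhds.1.continuousAt
  rw [h.1.self_of_nhds] at hB
  filter_upwards [h.2, hc.eventually hB] with z hz hBz k _
  refine contDiffAt_matCLM_iff.1 ?_
  simp only [pullback, LinearEquiv.apply_symm_apply]
  have hs := fun j => pullCoeff_smooth n hz.1 hz.2.1 hz.2.2.1 hBz j
  obtain ⟨u, hu⟩ := isUnit_pullCoeff_self n B hz.2.1 hz.2.2.2
  have hinv : ContDiffAt 𝕜 (smooth 𝕜) Ring.inverse (pullCoeff n f T B n z) :=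
    hu ▸ contDiffAt_ringInverse 𝕜 u
  exact (hinv.comp z (hs n)).mul (hs (n - k))

theorem LocalForm.normalFamily (h : LocalForm e f T p) {n : ℕ} (hn : 2 ≤ n) {B : Coeffs 𝕜 m}
    (hB : NormalFamily n B (e p).1) (hT : ∀ᶠ z in 𝓝 p.1, linCoeff f T n (n - 1) z = 0) :
    NormalFamily n (pullback n f T B) p.1 := by
  refine ⟨h.generalFamily hB.1, ?_⟩
  have hc := h.2.self_of_nhds.1.continuousAt
  have hB2 := hB.2
  rw [h.1.self_of_nhds] at hB2
  filter_upwards [hT, hc.eventually hB2] with z hz hBz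
  rw [pullback, pullCoeff_pred hn B hBz, hz, mul_zero, map_zero]

end LocalForm

/-! ### Comparison of the two test systems. -/

section Necessity

universe u

variable {𝕜 : Type u} [NontriviallyNormedField 𝕜] {m : ℕ}
  {e : OpenPartialHomeomorph (𝕜 × (Fin m → 𝕜)) (𝕜 × (Fin m → 𝕜))}

theorem IsPointTransformation.contDiffAt (he : IsPointTransformation e) {q : 𝕜 × (Fin m → 𝕜)}
    (hq : q ∈ e.source) : ContDiffAt 𝕜 (smooth 𝕜) e q :=
  he.1.contDiffAt (e.open_source.mem_nhds hq)

theorem IsPointTransformation.exists_inverse_fderiv (he : IsPointTransformation e)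
    {q : 𝕜 × (Fin m → 𝕜)} (hq : q ∈ e.source) :
    ∃ K : (𝕜 × (Fin m → 𝕜)) →L[𝕜] (𝕜 × (Fin m → 𝕜)),
      (∀ v, fderiv 𝕜 e q (K v) = v) ∧ ∀ v, K (fderiv 𝕜 e q v) = v := by
  have h1 := (eventually_differentiableAt (he.contDiffAt hq)).self_of_nhds.hasFDerivAt
  have h2 : ContDiffAt 𝕜 (smooth 𝕜) e.symm (e q) :=
    he.2.contDiffAt (e.open_target.mem_nhds (e.map_source hq))
  have h3 := (eventually_differentiableAt h2).self_of_nhds.hasFDerivAt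
  refine ⟨fderiv 𝕜 e.symm (e q), fun v => ?_, fun v => ?_⟩
  · have h1' : HasFDerivAt e (fderiv 𝕜 e q) (e.symm (e q)) := by rwa [e.left_inv hq]
    have h4 := h1'.comp (e q) h3
    have h5 : HasFDerivAt (e ∘ e.symm) (ContinuousLinearMap.id 𝕜 _) (e q) :=
      (hasFDerivAt_id (e q)).congr_of_eventuallyEq
        (e.eventually_right_inverse (e.map_source hq))
    exact DFunLike.congr_fun (h4.unique h5) v
  · have h4 := h3.comp q h1
    have h5 : HasFDerivAt (e.symm ∘ e) (ContinuousLinearMap.id 𝕜 _) q :=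
      (hasFDerivAt_id q).congr_of_eventuallyEq (e.eventually_left_inverse hq)
    exact DFunLike.congr_fun (h4.unique h5) v

theorem graph_smooth {w : 𝕜 → Fin m → 𝕜} {x : 𝕜} (hw : ContDiffAt 𝕜 (smooth 𝕜) w x) :
    ContDiffAt 𝕜 (smooth 𝕜) (fun z => (z, w z)) x :=
  contDiffAt_id.prodMk hw

theorem deriv_graph {w : 𝕜 → Fin m → 𝕜} {x : 𝕜} (hw : ContDiffAt 𝕜 (smooth 𝕜) w x) :
    deriv (fun z => (z, w z)) x = (1, deriv w x) :=
  ((hasDerivAt_id x).prodMk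
    (eventually_differentiableAt hw).self_of_nhds.hasDerivAt).deriv

theorem iteratedDeriv_graph_sub {w w' : 𝕜 → Fin m → 𝕜} {x : 𝕜}
    (hw : ContDiffAt 𝕜 (smooth 𝕜) w x) (hw' : ContDiffAt 𝕜 (smooth 𝕜) w' x) (k : ℕ) :
    iteratedDeriv k (fun z => (z, w' z) - (z, w z)) x =
      ((0 : 𝕜), iteratedDeriv k w' x - iteratedDeriv k w x) := by
  have : (fun z => (z, w' z) - (z, w z)) =
      fun z => ContinuousLinearMap.inr 𝕜 𝕜 (Fin m → 𝕜) (w' z - w z) := by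
    ext1 z; simp
  rw [this, iteratedDeriv_clm_comp _ k (hw'.sub hw), iteratedDeriv_fun_sub_smooth k hw' hw]
  rfl

theorem flatAt_graph_sub {w w' : 𝕜 → Fin m → 𝕜} {x : 𝕜} {k : ℕ}
    (hw : ContDiffAt 𝕜 (smooth 𝕜) w x) (hw' : ContDiffAt 𝕜 (smooth 𝕜) w' x)
    (h : ∀ i < k, iteratedDeriv i w' x = iteratedDeriv i w x) :
    FlatAt k (fun z => (z, w' z) - (z, w z)) x :=
  ⟨(graph_smooth hw').sub (graph_smooth hw), fun i hi => by
    rw [iteratedDeriv_graph_sub hw hw', h i hi, sub_self]; rfl⟩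

theorem deriv_fst_graph {q : 𝕜 × (Fin m → 𝕜)} (he : ContDiffAt 𝕜 (smooth 𝕜) e q)
    {w : 𝕜 → Fin m → 𝕜} (hw : ContDiffAt 𝕜 (smooth 𝕜) w q.1) (hwq : w q.1 = q.2) :
    deriv (fun z => e (z, w z)) q.1 = fderiv 𝕜 e q (1, deriv w q.1) ∧
    deriv (fun z => (e (z, w z)).1) q.1 = (fderiv 𝕜 e q (1, deriv w q.1)).1 ∧
    deriv (fun z => (e (z, w z)).2) q.1 = (fderiv 𝕜 e q (1, deriv w q.1)).2 := by
  have hq : (q.1, w q.1) = q := by rw [hwq]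
  have he' : ContDiffAt 𝕜 (smooth 𝕜) e (q.1, w q.1) := by rwa [hq]
  have h1 := (deriv_comp_curve he' (graph_smooth hw)).eq_of_nhds
  rw [deriv_graph hw, hq] at h1
  have h2 := (eventually_differentiableAt (he'.comp q.1 (graph_smooth hw))).self_of_nhds.hasDerivAt
  simp only [Function.comp_def] at h2
  rw [h1] at h2
  have h3 : HasDerivAt (fun z => (e (z, w z)).1) _ q.1 :=
    hasFDerivAt_fst.comp_hasDerivAt q.1 h2
  have h4 : HasDerivAt (fun z => (e (z, w z)).2) _ q.1 :=
    hasFDerivAt_snd.comp_hasDerivAt q.1 h2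
  exact ⟨h1, h3.deriv, h4.deriv⟩

theorem sum_Icc_mulVec (n : ℕ) (M : ℕ → Matrix (Fin m) (Fin m) 𝕜) (j : ℕ → Fin m → 𝕜) :
    ∑ k ∈ Finset.Icc 1 n, M k *ᵥ j (n - k) = ∑ i ∈ Finset.range n, M (n - i) *ᵥ j i := by
  rw [← sum_Icc_sub]
  refine Finset.sum_congr rfl fun k hk => ?_
  rw [Nat.sub_sub_self (Finset.mem_Icc.1 hk).2]

/-- The system leaves the jet below order `n` free and determines the derivative of order `n`. -/
theorem exists_curve_holdsAt [CharZero 𝕜] (n : ℕ) (H : Coeffs 𝕜 m) (x : 𝕜) (j : ℕ → Fin m → 𝕜) :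
    ∃ w : 𝕜 → Fin m → 𝕜, ContDiffAt 𝕜 (smooth 𝕜) w x ∧ (∀ k < n, iteratedDeriv k w x = j k) ∧
      iteratedDeriv n w x = -∑ i ∈ Finset.range n, H (n - i) x *ᵥ j i ∧
      HoldsAt n H x (fun k => iteratedDeriv k w x) := by
  obtain ⟨w, hw, hj⟩ := exists_curve_of_jet (𝕜 := 𝕜) n
    (fun k => if k < n then j k else -∑ i ∈ Finset.range n, H (n - i) x *ᵥ j i) x
  have h1 : ∀ k < n, iteratedDeriv k w x = j k := fun k hk => by rw [hj k hk.le, if_pos hk]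
  have h2 : iteratedDeriv n w x = -∑ i ∈ Finset.range n, H (n - i) x *ᵥ j i := by
    rw [hj n le_rfl, if_neg (lt_irrefl n)]
  refine ⟨w, hw, h1, h2, ?_⟩
  rw [HoldsAt, sum_Icc_mulVec n (fun k => H k x) (fun k => iteratedDeriv k w x), h2,
    neg_add_eq_zero]
  exact Finset.sum_congr rfl fun i hi => by rw [h1 i (Finset.mem_range.1 hi)]

/-- The equation `y^(n) + y = 0`. -/
def lastOne (𝕜 : Type u) [NontriviallyNormedField 𝕜] (m n : ℕ) : Coeffs 𝕜 m :=
  fun k _ => if k = n then 1 else 0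

theorem holdsAt_lastOne {n : ℕ} (hn : 1 ≤ n) (x : 𝕜) (j : ℕ → Fin m → 𝕜) :
    HoldsAt n (lastOne 𝕜 m n) x j ↔ j n + j 0 = 0 := by
  rw [HoldsAt, Finset.sum_eq_single_of_mem n (by simp; omega)]
  · simp [lastOne]
  · intro k _ hk
    simp [lastOne, hk]

theorem holdsAt_zero (n : ℕ) (x : 𝕜) (j : ℕ → Fin m → 𝕜) :
    HoldsAt n (fun _ _ => 0) x j ↔ j n = 0 := by
  simp [HoldsAt]

/-- The left side is the difference `v` of the `n`-th derivatives of two curves with common lower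
jet `(q.2, u, 0, …, 0)`, solving `H₁` and `H₀`. By `FlatAt.derivAlong_sub` their images have `n`-th
derivatives differing by a linear expression in `J (0, v)`, and this difference is `-y - 0`;
inverting `J` gives `v`. -/
theorem TransformsAt.sub_mulVec_eq [CharZero 𝕜] {n : ℕ} (hn : 2 ≤ n) {H₀ H₁ : Coeffs 𝕜 m}
    {q : 𝕜 × (Fin m → 𝕜)} (he : ContDiffAt 𝕜 (smooth 𝕜) e q)
    (h₀ : TransformsAt n e (fun _ _ => 0) H₀ q) (h₁ : TransformsAt n e (lastOne 𝕜 m n) H₁ q)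
    (hinj : Function.Injective (fderiv 𝕜 e q)) {a : 𝕜} {c : Fin m → 𝕜}
    (hac : fderiv 𝕜 e q (a, c) = (0, (e q).2)) {u : Fin m → 𝕜}
    (hD : (fderiv 𝕜 e q (1, u)).1 ≠ 0) :
    (H₀ n q.1 - H₁ n q.1) *ᵥ q.2 + (H₀ (n - 1) q.1 - H₁ (n - 1) q.1) *ᵥ u =
      (fderiv 𝕜 e q (1, u)).1 ^ n • (a • u - c) := by
  set j : ℕ → Fin m → 𝕜 := fun k => if k = 0 then q.2 else if k = 1 then u else 0
  obtain ⟨w₀, hw₀, hj₀, hn₀, hs₀⟩ := exists_curve_holdsAt n H₀ q.1 j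
  obtain ⟨w₁, hw₁, hj₁, hn₁, hs₁⟩ := exists_curve_holdsAt n H₁ q.1 j
  have hq₀ : w₀ q.1 = q.2 := by simpa [j] using hj₀ 0 (by omega)
  have hq₁ : w₁ q.1 = q.2 := by simpa [j] using hj₁ 0 (by omega)
  have hu₀ : deriv w₀ q.1 = u := by simpa [j] using hj₀ 1 (by omega)
  have hu₁ : deriv w₁ q.1 = u := by simpa [j] using hj₁ 1 (by omega)
  set v := iteratedDeriv n w₁ q.1 - iteratedDeriv n w₀ q.1 with hv
  have hvj : v = (H₀ n q.1 - H₁ n q.1) *ᵥ q.2 + (H₀ (n - 1) q.1 - H₁ (n - 1) q.1) *ᵥ u := by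
    have : ∀ H : Coeffs 𝕜 m, ∑ i ∈ Finset.range n, H (n - i) q.1 *ᵥ j i =
        H n q.1 *ᵥ q.2 + H (n - 1) q.1 *ᵥ u := by
      intro H
      obtain ⟨l, rfl⟩ : ∃ l, n = l + 2 := ⟨n - 2, by omega⟩
      rw [Finset.sum_range_succ', Finset.sum_range_succ', Finset.sum_eq_zero]
      · simp [j, add_comm]
      · intro i _
        simp [j]
    rw [hv, hn₀, hn₁, this, this, Matrix.sub_mulVec, Matrix.sub_mulVec]
    abel
  rw [← hvj]
  obtain ⟨-, hd₀, hd₀'⟩ := deriv_fst_graph he hw₀ hq₀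
  obtain ⟨-, hd₁, -⟩ := deriv_fst_graph he hw₁ hq₁
  rw [hu₀] at hd₀ hd₀'
  rw [hu₁] at hd₁
  set D := (fderiv 𝕜 e q (1, u)).1
  have hy₀ := (h₀ w₀ hw₀ hq₀ (by rwa [hd₀])).2 hs₀
  have hy₁ := (h₁ w₁ hw₁ hq₁ (by rwa [hd₁])).2 hs₁
  rw [holdsAt_zero] at hy₀
  rw [holdsAt_lastOne (by omega)] at hy₁
  have heq : (q.1, w₀ q.1) = q := by rw [hq₀]
  have he₀ : ContDiffAt 𝕜 (smooth 𝕜) e (q.1, w₀ q.1) := by rwa [heq]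
  have he₁ : ContDiffAt 𝕜 (smooth 𝕜) e (q.1, w₁ q.1) := by rwa [hq₁]
  have hflat := FlatAt.comp_sub he₀ (graph_smooth hw₀) (graph_smooth hw₁)
    (by rw [hq₀, hq₁]) (flatAt_graph_sub (k := n) hw₀ hw₁ fun i hi => by rw [hj₀ i hi, hj₁ i hi])
  rw [iteratedDeriv_graph_sub hw₀ hw₁, ← hv, heq] at hflat
  have hs₀ := he₀.comp q.1 (graph_smooth hw₀)
  have hs₁ := he₁.comp q.1 (graph_smooth hw₁)
  have hα := hflat.1.clm_comp (ContinuousLinearMap.fst 𝕜 𝕜 (Fin m → 𝕜))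
  have hβ := hflat.1.clm_comp (ContinuousLinearMap.snd 𝕜 𝕜 (Fin m → 𝕜))
  have hα' := iteratedDeriv_clm_comp (ContinuousLinearMap.fst 𝕜 𝕜 (Fin m → 𝕜)) n hflat.1.1
  have hβ' := iteratedDeriv_clm_comp (ContinuousLinearMap.snd 𝕜 𝕜 (Fin m → 𝕜)) n hflat.1.1
  rw [hflat.2] at hα' hβ'
  have key := (FlatAt.derivAlong_sub (i := 0) (j := n - 1) hn hs₀.fst hs₁.fst hs₀.snd hs₁.snd
    (by simpa only [Function.comp_def, hd₀] using hD) hα hβ (by omega)).2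
  simp only [Function.comp_def, ContinuousLinearMap.coe_fst', ContinuousLinearMap.coe_snd',
    Prod.fst_sub, Prod.snd_sub, iteratedDeriv_zero, Nat.sub_add_cancel (show 1 ≤ n by omega)]
    at key hα' hβ'
  rw [hy₀, sub_zero, hα', hβ', eq_neg_of_add_eq_zero_left hy₁, hd₀] at key
  simp only [derivAlong, hq₁, hd₀, hd₀'] at key
  set J := fderiv 𝕜 e q
  -- Subtracting `s` times the tangent `(1, u)` from `(0, v)` makes the `x`-component of the image
  -- zero, as it is for `(a, c)`.
  set s := (J (0, v)).1 * D⁻¹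
  have hJ : J (-s, v - s • u) = J (-(D ^ n * a), -(D ^ n • c)) := by
    have e1 : ((-s, v - s • u) : 𝕜 × (Fin m → 𝕜)) = (0, v) - s • (1, u) := by
      ext <;> simp
    have e2 : ((-(D ^ n * a), -(D ^ n • c)) : 𝕜 × (Fin m → 𝕜)) = -(D ^ n) • (a, c) := by
      ext <;> simp
    rw [e1, e2, map_sub, map_smul, map_smul, hac]
    refine Prod.ext ?_ ?_
    · simp only [Prod.fst_sub, Prod.smul_fst, smul_eq_mul, mul_zero, s]
      rw [mul_assoc, inv_mul_cancel₀ hD, mul_one, sub_self]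
    · have hDn : D ^ n ≠ 0 := pow_ne_zero n hD
      have k2 := congrArg (fun y => D ^ n • y) key
      simp only [smul_smul, inv_pow, mul_inv_cancel₀ hDn, one_smul] at k2
      simp only [Prod.snd_sub, Prod.smul_snd, neg_smul, Prod.snd_neg]
      rw [← smul_neg]
      exact k2.symm
  have hJ' := hinj hJ
  rw [Prod.mk.injEq] at hJ'
  have h3 := hJ'.2
  rw [neg_inj.1 hJ'.1, sub_eq_iff_eq_add] at h3
  rw [h3]
  module

/-- On a line in `u` along which `x₀ + ℓ u` is the parameter `t`, the left side has degree at most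
`1 < n`, while the right side has only terms in `t ^ n` and `t ^ (n + 1)`. Agreement for all `t ≠ 0`
makes both coefficients vanish. -/
theorem eq_zero_of_forall_pow_smul {n : ℕ} (hn : 2 ≤ n) {x₀ : 𝕜} {ℓ : (Fin m → 𝕜) →L[𝕜] 𝕜}
    (hℓ : ℓ ≠ 0) {k₀ : Fin m → 𝕜} {K : Matrix (Fin m) (Fin m) 𝕜} {a : 𝕜} {c : Fin m → 𝕜}
    (h : ∀ u, x₀ + ℓ u ≠ 0 → k₀ + K *ᵥ u = (x₀ + ℓ u) ^ n • (a • u - c)) : a = 0 ∧ c = 0 := by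
  obtain ⟨d, hd⟩ : ∃ d, ℓ d = 1 := by
    obtain ⟨v, hv⟩ : ∃ v, ℓ v ≠ 0 := by
      by_contra! hv
      exact hℓ (by ext1 v; simpa using hv v)
    exact ⟨(ℓ v)⁻¹ • v, by simp [hv]⟩
  obtain ⟨u₀, hu⟩ : ∃ u₀, ∀ t : 𝕜, x₀ + ℓ (u₀ + t • d) = t :=
    ⟨-x₀ • d, fun t => by simp [hd]⟩
  have hz : ∀ i, a * d i = 0 ∧ a * u₀ i - c i = 0 := by
    intro i
    let P : Polynomial 𝕜 := .C ((k₀ + K *ᵥ u₀) i) + .C ((K *ᵥ d) i) * .X -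
      .C (a * u₀ i - c i) * .X ^ n - .C (a * d i) * .X ^ (n + 1)
    have hP : P = 0 := by
      refine Polynomial.eq_zero_of_infinite_isRoot P (Set.Infinite.mono (s := {0}ᶜ) ?_
        (Set.finite_singleton (0 : 𝕜)).infinite_compl)
      intro t ht
      have h1 := congrFun (h (u₀ + t • d) (by rw [hu]; exact ht)) i
      rw [hu, Matrix.mulVec_add, Matrix.mulVec_smul] at h1
      simp only [Pi.add_apply, Pi.smul_apply, Pi.sub_apply, smul_eq_mul] at h1
      simp only [Set.mem_ofPred_eq, Polynomial.IsRoot.def, P, Polynomial.eval_add,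
        Polynomial.eval_sub, Polynomial.eval_mul, Polynomial.eval_C, Polynomial.eval_X,
        Polynomial.eval_pow, Pi.add_apply]
      rw [pow_succ]
      linear_combination h1
    have c1 := congrArg (fun R => Polynomial.coeff R n) hP
    have c2 := congrArg (fun R => Polynomial.coeff R (n + 1)) hP
    simp only [P, Polynomial.coeff_add, Polynomial.coeff_sub, Polynomial.coeff_C_mul,
      Polynomial.coeff_X_pow, Polynomial.coeff_C, Polynomial.coeff_X,
      Polynomial.coeff_zero] at c1 c2
    simp only [if_neg (show n ≠ 0 by omega), if_neg (show 1 ≠ n by omega),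
      if_neg (show n ≠ n + 1 by omega), if_true] at c1
    simp only [if_neg (show n + 1 ≠ 0 by omega), if_neg (show 1 ≠ n + 1 by omega),
      if_neg (show n + 1 ≠ n by omega), if_true] at c2
    exact ⟨by linear_combination -c2, by linear_combination -c1⟩
  have ha : a • d = 0 := funext fun i => (hz i).1
  have ha0 : a = 0 := by simpa [hd] using congrArg ℓ ha
  refine ⟨ha0, funext fun i => ?_⟩
  have := (hz i).2
  rw [ha0] at this
  simpa using this

end Necessity

/-! ### The transformation is fibre-preserving and linear in `w`. -/

section NecessityLinear

universe u

variable {𝕜 : Type u} [NontriviallyNormedField 𝕜] [CharZero 𝕜] {m : ℕ}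
  {e : OpenPartialHomeomorph (𝕜 × (Fin m → 𝕜)) (𝕜 × (Fin m → 𝕜))}

/-- Put `σ • b` into `w'` and `τ • c` into `w^(n-1)`. In the condition `y^(n) = 0`, the difference
between `τ = 1` and `τ = 0` is affine in `σ`, and its `σ`-coefficient is a nonzero multiple of `y_ww
(b, c)`. -/
theorem TransformsAt.fderiv_fderiv_snd_eq_zero {n : ℕ} (hn : 2 ≤ n) {H : Coeffs 𝕜 m}
    {q : 𝕜 × (Fin m → 𝕜)} (he : ContDiffAt 𝕜 (smooth 𝕜) e q)
    (ht : TransformsAt n e (fun _ _ => 0) H q) {f : 𝕜 → 𝕜}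
    (hef : ∀ᶠ r in 𝓝 q, (e r).1 = f r.1) (hf : ContDiffAt 𝕜 (smooth 𝕜) f q.1)
    (hf' : deriv f q.1 ≠ 0) (b c : Fin m → 𝕜) :
    (fderiv 𝕜 (fderiv 𝕜 e) q (0, b) (0, c)).2 = 0 := by
  obtain ⟨k, rfl⟩ : ∃ k, n = k + 2 := ⟨n - 2, by omega⟩
  -- The entries are added, not chosen by cases, because orders `1` and `k + 1` coincide when `n =
  -- 2`.
  set j : 𝕜 → 𝕜 → ℕ → Fin m → 𝕜 := fun σ τ i => (if i = 0 then q.2 else 0) +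
    ((if i = 1 then σ • b else 0) + if i = k + 1 then τ • c else 0)
  choose W hW hj hjn hs using fun σ τ => exists_curve_holdsAt (k + 2) H q.1 (j σ τ)
  have hq : ∀ σ τ, W σ τ q.1 = q.2 := fun σ τ => by simpa [j] using hj σ τ 0 (by omega)
  have hd : ∀ σ τ, deriv (W σ τ) q.1 = σ • b + if 1 = k + 1 then τ • c else 0 := fun σ τ => by
    simpa [j] using hj σ τ 1 (by omega)
  have hq' : ∀ σ τ, (q.1, W σ τ q.1) = q := fun σ τ => by rw [hq]
  have he' : ∀ σ τ, ContDiffAt 𝕜 (smooth 𝕜) e (q.1, W σ τ q.1) := fun σ τ => by rwa [hq']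
  have hγ := fun σ τ => graph_smooth (hW σ τ)
  have hY := fun σ τ => ((he' σ τ).comp q.1 (hγ σ τ)).snd
  simp only [Function.comp_def] at hY
  have hF : ∀ σ τ, (fun z => (e (z, W σ τ z)).1) =ᶠ[𝓝 q.1] f := fun σ τ => by
    have hc := (hγ σ τ).continuousAt
    have hef' : ∀ᶠ r in 𝓝 (q.1, W σ τ q.1), (e r).1 = f r.1 := by rwa [hq']
    exact hc.eventually hef'
  have hone : ContDiffAt 𝕜 (smooth 𝕜) (fun _ : 𝕜 => (1 : (Fin m → 𝕜) →L[𝕜] (Fin m → 𝕜))) q.1 :=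
    contDiffAt_const
  -- As `x = f(z)`, taking `T = 1` expands the `n`-th `x`-derivative of `y` in its `z`-derivatives.
  have hsum : ∀ σ τ, ∑ i ∈ Finset.range (k + 3), linCoeff f (fun _ => 1) (k + 2) i q.1
      (iteratedDeriv i (fun z => (e (z, W σ τ z)).2) q.1) = 0 := by
    intro σ τ
    have h1 := (ht (W σ τ) (hW σ τ) (hq σ τ) (by rwa [(hF σ τ).deriv_eq])).2 (hs σ τ)
    rw [holdsAt_zero, (derivAlong_congr (hF σ τ) Filter.EventuallyEq.rfl _).eq_of_nhds] at h1
    exact (derivAlong_linear hf hf' hone (hY σ τ) (k + 2)).eq_of_nhds.symm.trans h1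
  set J := fderiv 𝕜 e q
  set J₂ := fderiv 𝕜 (fderiv 𝕜 e) q
  set r := -∑ i ∈ Finset.range (k + 2), H (k + 2 - i) q.1 *ᵥ (if i = k + 1 then c else 0)
  have hflat : ∀ σ, FlatAt (k + 1) (fun z => (z, W σ 1 z) - (z, W σ 0 z)) q.1 := fun σ =>
    flatAt_graph_sub (hW σ 0) (hW σ 1) fun i hi => by
      rw [hj σ 1 i (by omega), hj σ 0 i (by omega)]
      simp [j, if_neg (show i ≠ k + 1 by omega)]
  have hΔ : ∀ σ, iteratedDeriv (k + 1) (fun z => (z, W σ 1 z) - (z, W σ 0 z)) q.1 = (0, c) := by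
    intro σ
    rw [iteratedDeriv_graph_sub (hW σ 0) (hW σ 1), hj σ 1 _ (by omega), hj σ 0 _ (by omega)]
    simp [j]
  have hΔ' : ∀ σ, iteratedDeriv (k + 2) (fun z => (z, W σ 1 z) - (z, W σ 0 z)) q.1 = (0, r) := by
    intro σ
    rw [iteratedDeriv_graph_sub (hW σ 0) (hW σ 1), hjn σ 1, hjn σ 0]
    refine Prod.ext rfl ?_
    simp only [r, neg_sub_neg, ← Finset.sum_sub_distrib, ← Finset.sum_neg_distrib]
    refine Finset.sum_congr rfl fun i _ => ?_
    rw [← Matrix.mulVec_sub, ← Matrix.mulVec_neg]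
    simp only [j, one_smul, zero_smul, ite_self, add_zero]
    congr 1
    abel
  have hX : ∀ σ : 𝕜, (deriv f q.1)⁻¹ ^ (k + 2) •
      (J₂ (0, c) (1, σ • b + if 1 = k + 1 then c else 0) +
        (J (0, r) + ((k + 1 : ℕ) : 𝕜) • J₂ (1, σ • b) (0, c))).2 +
      linCoeff f (fun _ => 1) (k + 2) (k + 1) q.1 (J (0, c)).2 = 0 := by
    intro σ
    have h1 := FlatAt.comp_sub (he' σ 0) (hγ σ 0) (hγ σ 1) (by rw [hq, hq]) (hflat σ)
    have h2 := FlatAt.iteratedDeriv_succ_comp_sub (he' σ 0) (hγ σ 0) (hγ σ 1) (by rw [hq, hq])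
      (hflat σ)
    rw [hΔ, hΔ', deriv_graph (hW σ 0), deriv_graph (hW σ 1), hd, hd, hq'] at h2
    rw [hΔ, hq'] at h1
    have hβ : ∀ i, iteratedDeriv i (fun z => (e (z, W σ 1 z)).2) q.1 -
        iteratedDeriv i (fun z => (e (z, W σ 0 z)).2) q.1 =
        (iteratedDeriv i (fun z => e (z, W σ 1 z) - e (z, W σ 0 z)) q.1).2 := by
      intro i
      rw [← iteratedDeriv_fun_sub_smooth i (hY σ 1) (hY σ 0)]
      exact iteratedDeriv_clm_comp (ContinuousLinearMap.snd 𝕜 𝕜 (Fin m → 𝕜)) i h1.1.1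
    have h3 := congrArg₂ (· - ·) (hsum σ 1) (hsum σ 0)
    simp only [sub_self] at h3
    rw [← Finset.sum_sub_distrib] at h3
    simp only [← map_sub, hβ] at h3
    rw [Finset.sum_range_succ, Finset.sum_range_succ, Finset.sum_eq_zero, zero_add, h2, h1.2,
      linCoeff_self] at h3
    · rw [add_comm]
      simpa only [smul_apply, one_apply_eq_self, one_smul, zero_smul, ite_self, add_zero] using h3
    · intro i hi
      rw [h1.1.2 i (Finset.mem_range.1 hi), Prod.snd_zero, map_zero]
  have hinv : (deriv f q.1)⁻¹ ^ (k + 2) ≠ 0 := pow_ne_zero _ (inv_ne_zero hf')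
  have h4 := smul_right_injective _ hinv (add_right_cancel ((hX 1).trans (hX 0).symm))
  have hsymm : J₂ (0, c) (0, b) = J₂ (0, b) (0, c) :=
    (he.isSymmSndFDerivAt minSmoothness_two_le) (0, c) (0, b)
  have e1 : ((1, (1 : 𝕜) • b + if 1 = k + 1 then c else 0) : 𝕜 × (Fin m → 𝕜)) =
      (1, (0 : 𝕜) • b + if 1 = k + 1 then c else 0) + (0, b) := by
    ext1 <;> simp [add_comm]
  have e2 : ((1, (1 : 𝕜) • b) : 𝕜 × (Fin m → 𝕜)) = (1, (0 : 𝕜) • b) + (0, b) := by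
    ext1 <;> simp
  rw [e1, e2, map_add, map_add, add_apply, smul_add, hsymm] at h4
  simp only [Prod.snd_add, Prod.smul_snd] at h4
  -- One copy of the second derivative comes from the variation of `fderiv 𝕜 e` and `k + 1` from the
  -- Leibniz rule; symmetry merges them.
  have h5 : ((k + 2 : ℕ) : 𝕜) • (J₂ (0, b) (0, c)).2 = 0 := by
    rw [← sub_eq_zero.2 h4]
    push_cast
    module
  exact (smul_eq_zero.1 h5).resolve_left (Nat.cast_ne_zero.2 (by omega))

/-- Wherever `x_w ≠ 0`, the polynomial argument gives `y = 0`. The condition `x_w ≠ 0` is open, so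
`y` would vanish near such a point and `fderiv 𝕜 e` could not be onto. -/
theorem eventually_fderiv_fst_eq_zero {n : ℕ} (hm : 1 ≤ m) (hn : 2 ≤ n)
    (he : IsPointTransformation e) {p : 𝕜 × (Fin m → 𝕜)} (hp : p ∈ e.source)
    {H₀ H₁ : Coeffs 𝕜 m} (h₀ : ∀ᶠ q in 𝓝 p, TransformsAt n e (fun _ _ => 0) H₀ q)
    (h₁ : ∀ᶠ q in 𝓝 p, TransformsAt n e (lastOne 𝕜 m n) H₁ q) :
    ∀ᶠ q in 𝓝 p, ∀ v, (fderiv 𝕜 e q (0, v)).1 = 0 := by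
  have key : ∀ᶠ q in 𝓝 p, (∃ v, (fderiv 𝕜 e q (0, v)).1 ≠ 0) → (e q).2 = 0 := by
    filter_upwards [h₀, h₁, e.open_source.mem_nhds hp] with q h2 h3 hq hv
    obtain ⟨K, hJK, hKJ⟩ := he.exists_inverse_fderiv hq
    set J := fderiv 𝕜 e q
    have hac : J ((K (0, (e q).2)).1, (K (0, (e q).2)).2) = (0, (e q).2) := by
      rw [Prod.mk.eta, hJK]
    have hu : ∀ u, J (1, u) = J (1, 0) + J (0, u) := fun u => by
      rw [← map_add]; simp
    have := eq_zero_of_forall_pow_smul hn (x₀ := (J (1, 0)).1)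
      (ℓ := (ContinuousLinearMap.fst 𝕜 𝕜 (Fin m → 𝕜)).comp
        (J.comp (ContinuousLinearMap.inr 𝕜 𝕜 (Fin m → 𝕜))))
      (k₀ := (H₀ n q.1 - H₁ n q.1) *ᵥ q.2) (K := H₀ (n - 1) q.1 - H₁ (n - 1) q.1)
      (a := (K (0, (e q).2)).1) (c := (K (0, (e q).2)).2) ?_ ?_
    · rw [this.1, this.2] at hac
      have h4 := congrArg Prod.snd hac
      rw [show ((0 : 𝕜), (0 : Fin m → 𝕜)) = 0 from rfl, map_zero] at h4
      exact h4.symm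
    · intro h0
      obtain ⟨v, hv⟩ := hv
      exact hv (DFunLike.congr_fun h0 v)
    · intro u hD
      have hD' : (J (1, 0)).1 + ((ContinuousLinearMap.fst 𝕜 𝕜 (Fin m → 𝕜)).comp
        (J.comp (ContinuousLinearMap.inr 𝕜 𝕜 (Fin m → 𝕜)))) u = (J (1, u)).1 := by
        rw [hu u]; rfl
      rw [hD'] at hD ⊢
      exact h2.sub_mulVec_eq hn (he.contDiffAt hq) h3
        (Function.LeftInverse.injective (g := K) hKJ) hac hD
  filter_upwards [key.eventually_nhds, e.open_source.mem_nhds hp] with q hq hqs v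
  by_contra hv
  have hsm := he.contDiffAt hqs
  have hc : ContinuousAt (fun r => (fderiv 𝕜 e r (0, v)).1) q :=
    (((fderiv_smooth hsm).clm_apply contDiffAt_const).fst).continuousAt
  have hz : (fun r => (e r).2) =ᶠ[𝓝 q] fun _ => 0 := by
    filter_upwards [hq, hc.eventually_ne hv] with r h4 h5
    exact h4 ⟨v, h5⟩
  have hd : HasFDerivAt (fun r => (e r).2)
      ((ContinuousLinearMap.snd 𝕜 𝕜 (Fin m → 𝕜)).comp (fderiv 𝕜 e q)) q :=
    (eventually_differentiableAt hsm).self_of_nhds.hasFDerivAt.snd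
  have h0 := hd.unique ((hasFDerivAt_const (0 : Fin m → 𝕜) q).congr_of_eventuallyEq hz)
  obtain ⟨K, hJK, -⟩ := he.exists_inverse_fderiv hqs
  have h1 := DFunLike.congr_fun h0 (K (0, fun _ => 1))
  simp only [ContinuousLinearMap.comp_apply, hJK, ContinuousLinearMap.coe_snd', zero_apply] at h1
  exact one_ne_zero (congrFun h1 ⟨0, hm⟩)

theorem exists_localForm [CompleteSpace 𝕜] {n : ℕ} (hm : 1 ≤ m) (hn : 2 ≤ n)
    (he : IsPointTransformation e)
    {p : 𝕜 × (Fin m → 𝕜)} (hp : p ∈ e.source) {H₀ H₁ : Coeffs 𝕜 m}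
    (h₀ : ∀ᶠ q in 𝓝 p, TransformsAt n e (fun _ _ => 0) H₀ q)
    (h₁ : ∀ᶠ q in 𝓝 p, TransformsAt n e (lastOne 𝕜 m n) H₁ q) :
    ∃ f T, LocalForm e f T p := by
  have hX := eventually_fderiv_fst_eq_zero hm hn he hp h₀ h₁
  have hsrc := e.open_source.mem_nhds hp
  have hsm := he.contDiffAt hp
  have hdiff : ∀ᶠ q in 𝓝 p, DifferentiableAt 𝕜 e q := eventually_differentiableAt hsm
  have hline : Filter.Tendsto (fun z => (z, p.2)) (𝓝 p.1) (𝓝 p) :=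
    (Continuous.prodMk_left p.2).tendsto p.1
  let f : 𝕜 → 𝕜 := fun z => (e (z, p.2)).1
  let L := fun q => (ContinuousLinearMap.snd 𝕜 𝕜 (Fin m → 𝕜)).comp
    ((fderiv 𝕜 e q).comp (ContinuousLinearMap.inr 𝕜 𝕜 (Fin m → 𝕜)))
  let T : 𝕜 → (Fin m → 𝕜) →L[𝕜] (Fin m → 𝕜) := fun z => L (z, p.2)
  have hLs : ∀ q ∈ e.source, ContDiffAt 𝕜 (smooth 𝕜) L q := fun q hq =>
    contDiffAt_const.clm_comp ((fderiv_smooth (he.contDiffAt hq)).clm_comp contDiffAt_const)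
  have hef : ∀ᶠ q in 𝓝 p, (e q).1 = f q.1 := by
    refine eventually_eq_of_fderiv_snd_eq_zero hsm.fst ?_
    filter_upwards [hX, hdiff] with q h2 h3 v
    rw [h3.hasFDerivAt.fst.fderiv]
    exact h2 v
  have hfs : ∀ᶠ z in 𝓝 p.1, ContDiffAt 𝕜 (smooth 𝕜) f z := by
    filter_upwards [hline.eventually hsrc] with z hz
    exact ((he.contDiffAt hz).comp z (contDiffAt_id.prodMk contDiffAt_const)).fst
  have hTs : ∀ᶠ z in 𝓝 p.1, ContDiffAt 𝕜 (smooth 𝕜) T z := by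
    filter_upwards [hline.eventually hsrc] with z hz
    exact (hLs _ hz).comp z (contDiffAt_id.prodMk contDiffAt_const)
  have hD : ∀ᶠ q in 𝓝 p, (fderiv 𝕜 e q (1, 0)).1 = deriv f q.1 := by
    filter_upwards [hef.eventually_nhds, hdiff, eventually_fst hfs] with q h2 h3 h4
    have h5 := h3.hasFDerivAt.fst
    have h6 := ((eventually_differentiableAt h4).self_of_nhds.hasFDerivAt.comp q
      hasFDerivAt_fst).congr_of_eventuallyEq (f₁ := fun r => (e r).1) h2
    have h7 := DFunLike.congr_fun (h5.unique h6) (1, 0)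
    simpa [fderiv_eq_smul_deriv] using h7
  have hJ : ∀ᶠ q in 𝓝 p, ∀ a v, (fderiv 𝕜 e q (a, v)).1 = a * deriv f q.1 := by
    filter_upwards [hX, hD] with q h2 h3 a v
    have : ((a, v) : 𝕜 × (Fin m → 𝕜)) = a • (1, 0) + (0, v) := by ext1 <;> simp
    rw [this, map_add, map_smul, Prod.fst_add, h2, Prod.smul_fst, h3, smul_eq_mul, add_zero]
  have hf' : ∀ᶠ q in 𝓝 p, deriv f q.1 ≠ 0 := by
    filter_upwards [hJ, hsrc] with q h2 h3 h4
    obtain ⟨K, hJK, -⟩ := he.exists_inverse_fderiv h3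
    have h5 := h2 (K (1, 0)).1 (K (1, 0)).2
    rw [Prod.mk.eta, hJK, h4, mul_zero] at h5
    exact one_ne_zero h5
  have hLT : ∀ᶠ q in 𝓝 p, L q = T q.1 := by
    refine eventually_eq_of_fderiv_snd_eq_zero (hLs p hp) ?_
    filter_upwards [h₀, hsrc, hef.eventually_nhds, eventually_fst hfs, hf'] with q h2 h3 h4 h5 h6 b
    have h7 := (eventually_differentiableAt
      (fderiv_smooth (he.contDiffAt h3))).self_of_nhds.hasFDerivAt
    ext1 c
    have hLd := (eventually_differentiableAt (hLs q h3)).self_of_nhds.hasFDerivAt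
    have h9 : HasFDerivAt (fun r => L r c) ((fderiv 𝕜 L q).flip c) q := by
      simpa using hLd.clm_apply (hasFDerivAt_const c q)
    have h10 : HasFDerivAt (fun r => (fderiv 𝕜 e r (0, c)).2)
        ((ContinuousLinearMap.snd 𝕜 𝕜 (Fin m → 𝕜)).comp
          ((fderiv 𝕜 (fderiv 𝕜 e) q).flip (0, c))) q := by
      have := (h7.clm_apply (hasFDerivAt_const ((0 : 𝕜), c) q)).snd
      simpa using this
    have h11 := DFunLike.congr_fun (h9.unique h10) (0, b)
    exact h11.trans (h2.fderiv_fderiv_snd_eq_zero hn (he.contDiffAt h3) h4 h5 h6 b c)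
  -- Since `y_w = T(z)`, the remainder `y - T(z) w` depends on `z` only.
  have hR : ∀ᶠ q in 𝓝 p, (e q).2 - T q.1 q.2 = (e (q.1, p.2)).2 - T q.1 p.2 := by
    refine eventually_eq_of_fderiv_snd_eq_zero (g := fun q => (e q).2 - T q.1 q.2)
      (hsm.snd.sub (ContDiffAt.clm_apply (hTs.self_of_nhds.comp p contDiffAt_fst)
        contDiffAt_snd)) ?_
    filter_upwards [hLT, hdiff, eventually_fst hTs] with q h2 h3 h4 v
    have h5 := (eventually_differentiableAt h4).self_of_nhds.hasFDerivAt.comp q hasFDerivAt_fst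
    have h6 := h3.hasFDerivAt.snd.sub (h5.clm_apply hasFDerivAt_snd)
    refine (DFunLike.congr_fun h6.fderiv (0, v)).trans ?_
    have h7 := DFunLike.congr_fun h2 v
    simp only [L, ContinuousLinearMap.comp_apply, ContinuousLinearMap.coe_snd',
      ContinuousLinearMap.inr_apply] at h7
    simp [h7]
  -- The comparison identity at `u = 0`, where now `a = 0`, exhibits `y` as linear in `w` for fixed
  -- `z`.
  have hN : ∀ᶠ q in 𝓝 p, (e q).2 = T q.1 (-((deriv f q.1)⁻¹ ^ n) •
      ((H₀ n q.1 - H₁ n q.1) *ᵥ q.2)) := by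
    filter_upwards [hJ, hf', hLT, h₀, h₁, hsrc] with q h2 h3 h4 h5 h6 h7
    obtain ⟨K, hJK, hKJ⟩ := he.exists_inverse_fderiv h7
    obtain ⟨⟨a, c⟩, hac⟩ : ∃ v, fderiv 𝕜 e q v = (0, (e q).2) := ⟨_, hJK _⟩
    have ha : a = 0 := by
      have := h2 a c
      rw [hac] at this
      exact (mul_eq_zero.1 this.symm).resolve_right h3
    subst ha
    have h8 := h5.sub_mulVec_eq hn (he.contDiffAt h7) h6
        (Function.LeftInverse.injective (g := K) hKJ) hac (u := 0) (by simpa [h2] using h3)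
    rw [h2, one_mul, Matrix.mulVec_zero, add_zero, zero_smul, zero_sub] at h8
    rw [h8, smul_smul, smul_neg, neg_mul, neg_smul, neg_neg, inv_pow,
      inv_mul_cancel₀ (pow_ne_zero n h3), one_smul, ← h4]
    exact (congrArg Prod.snd hac).symm
  have hform : ∀ᶠ q in 𝓝 p, (e q).2 = T q.1 q.2 := by
    filter_upwards [(hR.and hN).eventually_nhds] with q hq
    -- A linear map that is constant near a point is zero, so the remainder vanishes.
    let M : (Fin m → 𝕜) →L[𝕜] (Fin m → 𝕜) := T q.1 *
      (-((deriv f q.1)⁻¹ ^ n) • matCLM 𝕜 m (H₀ n q.1 - H₁ n q.1)) - T q.1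
    have hM : (fun w => M w) =ᶠ[𝓝 q.2] fun _ => (e (q.1, p.2)).2 - T q.1 p.2 := by
      have hc : Filter.Tendsto (fun w => (q.1, w)) (𝓝 q.2) (𝓝 q) :=
        (Continuous.prodMk_right q.1).tendsto q.2
      filter_upwards [hc.eventually hq] with w hw
      rw [← hw.1, hw.2]
      simp [M, Matrix.sub_mulVec]
    have hM0 : M = 0 := M.hasFDerivAt.unique
      ((hasFDerivAt_const ((e (q.1, p.2)).2 - T q.1 p.2) q.2).congr_of_eventuallyEq hM)
    have h2 := hM.eq_of_nhds
    rw [hM0, zero_apply, ← hq.self_of_nhds.1, eq_comm, sub_eq_zero] at h2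
    exact h2
  refine ⟨f, T, ?_, ?_⟩
  · filter_upwards [hef, hform] with q h2 h3
    exact Prod.ext h2 h3
  · filter_upwards [hfs, hTs, hline.eventually hf', hline.eventually hsrc, hline.eventually hJ]
      with z h2 h3 h4 h5 h6
    refine ⟨h2, h4, h3, ?_⟩
    obtain ⟨K, hJK, hKJ⟩ := he.exists_inverse_fderiv h5
    set J := fderiv 𝕜 e (z, p.2)
    have hTJ : ∀ v, T z v = (J (0, v)).2 := fun v => rfl
    let S : (Fin m → 𝕜) →L[𝕜] (Fin m → 𝕜) := (ContinuousLinearMap.snd 𝕜 𝕜 (Fin m → 𝕜)).comp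
      (K.comp (ContinuousLinearMap.inr 𝕜 𝕜 (Fin m → 𝕜)))
    have hS : ∀ v, S v = (K (0, v)).2 := fun v => rfl
    refine ⟨⟨T z, S, ?_, ?_⟩, rfl⟩ <;> ext1 v <;> rw [clm_mul_apply, one_apply_eq_self]
    · have h7 := h6 (K (0, v)).1 (K (0, v)).2
      rw [Prod.mk.eta, hJK] at h7
      have h8 : (K (0, v)).1 = 0 := (mul_eq_zero.1 h7.symm).resolve_right h4
      have h9 : ((0 : 𝕜), (K (0, v)).2) = K (0, v) := Prod.ext h8.symm rfl
      rw [hTJ, hS, h9, hJK]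
    · have h7 : J (0, v) = (0, T z v) := Prod.ext (by rw [h6, zero_mul]) rfl
      rw [hS, ← h7, hKJ]

end NecessityLinear

/-! ### Matrix forms and the equation for `T`. -/

section Forms

universe u

variable {𝕜 : Type u} [NontriviallyNormedField 𝕜] {m : ℕ}
  {e : OpenPartialHomeomorph (𝕜 × (Fin m → 𝕜)) (𝕜 × (Fin m → 𝕜))} {f : 𝕜 → 𝕜}
  {T : 𝕜 → (Fin m → 𝕜) →L[𝕜] (Fin m → 𝕜)} {p : 𝕜 × (Fin m → 𝕜)}
  {S : Set (𝕜 × (Fin m → 𝕜))}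

theorem LocalForm.eventually (h : LocalForm e f T p) : ∀ᶠ q in 𝓝 p, LocalForm e f T q := by
  filter_upwards [h.1.eventually_nhds, eventually_fst h.2.eventually_nhds] with q h1 h2
  exact ⟨h1, h2⟩

theorem exists_localForm_of_eqOn (hS : S ∈ 𝓝 p)
    (hf : ∀ z ∈ Prod.fst '' S, ContDiffAt 𝕜 (smooth 𝕜) f z ∧ deriv f z ≠ 0 ∧
      ContDiffAt 𝕜 (smooth 𝕜) T z ∧ IsUnit (T z))
    (he : ∀ q ∈ S, e q = (f q.1, T q.1 q.2)) : LocalForm e f T p :=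
  ⟨Filter.mem_of_superset hS he, Filter.mem_of_superset (isOpenMap_fst.image_mem_nhds hS) hf⟩

section

theorem linCoeff_pred_eq_zero_iff [CharZero 𝕜]
    (hf : ContDiffAt 𝕜 (smooth 𝕜) f p.1) (hf' : deriv f p.1 ≠ 0)
    (hT : ContDiffAt 𝕜 (smooth 𝕜) T p.1) (k : ℕ) :
    (∀ᶠ z in 𝓝 p.1, linCoeff f T (k + 1) k z = 0) ↔
      ∀ᶠ z in 𝓝 p.1, deriv T z = ((k : 𝕜) / 2 * (deriv (deriv f) z / deriv f z)) • T z := by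
  refine Filter.eventually_congr ?_
  filter_upwards [linCoeff_succ_self hf hf' hT k,
    (deriv_smooth hf).continuousAt.eventually_ne hf'] with z h1 h2
  have h3 : (k + 1 : 𝕜) * (deriv f z)⁻¹ ^ (k + 1) ≠ 0 :=
    mul_ne_zero (by exact_mod_cast k.succ_ne_zero) (pow_ne_zero _ (inv_ne_zero h2))
  rw [h1]
  refine ⟨fun h => sub_eq_zero.1 ((smul_eq_zero.1 h).resolve_left h3), fun h => ?_⟩
  rw [sub_eq_zero.2 h]
  exact ContinuousLinearMap.ext fun v => smul_zero ((k + 1 : 𝕜) * (deriv f z)⁻¹ ^ (k + 1))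

variable [CompleteSpace 𝕜]

theorem HasStandardForm.exists_localForm (h : HasStandardForm e S) (hS : S ∈ 𝓝 p) :
    ∃ f T, LocalForm e f T p := by
  obtain ⟨f, T, hf, he⟩ := h
  refine ⟨f, fun z => matCLM 𝕜 m (T z), exists_localForm_of_eqOn hS (fun z hz => ?_) fun q hq => ?_⟩
  · obtain ⟨h1, h2, h3, h4⟩ := hf z hz
    exact ⟨h1, h2, contDiffAt_matCLM_iff.2 h3, isUnit_matCLM_iff.2 h4⟩
  · rw [he q hq, matCLM_apply]

theorem hasStandardForm_of_localForm (h : ∀ q ∈ S, LocalForm e f T q) : HasStandardForm e S := by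
  refine ⟨f, fun z => (matCLM 𝕜 m).symm (T z), ?_, fun q hq => ?_⟩
  · rintro _ ⟨q, hq, rfl⟩
    obtain ⟨h1, h2, h3, h4⟩ := (h q hq).2.self_of_nhds
    refine ⟨h1, h2, contDiffAt_matCLM_iff.1 ?_, isUnit_matCLM_iff.1 ?_⟩
    · simpa using h3
    · simpa using h4
  · rw [← matCLM_apply, LinearEquiv.apply_symm_apply]
    exact (h q hq).1.self_of_nhds

variable [CharZero 𝕜]

theorem HasNormalForm.exists_localForm {n : ℕ} (hn : 2 ≤ n) (h : HasNormalForm n e S)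
    (hS : S ∈ 𝓝 p) :
    ∃ f T, LocalForm e f T p ∧ ∀ᶠ z in 𝓝 p.1, linCoeff f T n (n - 1) z = 0 := by
  obtain ⟨k, rfl⟩ : ∃ k, n = k + 2 := ⟨n - 2, by omega⟩
  obtain ⟨f, g, c, C, hc, hC, hfg, he⟩ := h
  have hg0 : ∀ z ∈ Prod.fst '' S, g z ≠ 0 := fun z hz h0 => by
    obtain ⟨-, h1, -, h2⟩ := hfg z hz
    rw [h0, zero_pow two_ne_zero] at h2
    exact mul_ne_zero hc (pow_ne_zero _ h1) h2.symm
  have hloc : LocalForm e f (fun z => g z • matCLM 𝕜 m C) p :=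
    exists_localForm_of_eqOn hS (fun z hz => by
      obtain ⟨h1, h2, h3, h4⟩ := hfg z hz
      exact ⟨h1, h2, h3.smul contDiffAt_const, isUnit_smul_clm (hg0 z hz) (isUnit_matCLM_iff.2 hC)⟩)
      fun q hq => by rw [he q hq, smul_apply, matCLM_apply]
  refine ⟨f, _, hloc, ?_⟩
  obtain ⟨h1, h2, h3, -⟩ := hloc.2.self_of_nhds
  refine (linCoeff_pred_eq_zero_iff h1 h2 h3 (k + 1)).2 ?_
  have hI : ∀ᶠ z in 𝓝 p.1, z ∈ Prod.fst '' S := isOpenMap_fst.image_mem_nhds hS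
  filter_upwards [hI.eventually_nhds] with z hz
  obtain ⟨h4, h5, h6, h7⟩ := hfg z hz.self_of_nhds
  have hgz := hg0 z hz.self_of_nhds
  have hgd := (eventually_differentiableAt h6).self_of_nhds.hasDerivAt
  have hfd := (eventually_differentiableAt (deriv_smooth h4)).self_of_nhds.hasDerivAt
  -- Differentiating `g ^ 2 = c f'^(n-1)` gives `g' / g = (n-1)/2 · f''/f'`, with no need to choose
  -- a root.
  have hsq : deriv (fun z => g z ^ 2) z = deriv (fun z => c * deriv f z ^ (k + 1)) z :=
    Filter.EventuallyEq.deriv_eq (hz.mono fun t ht => (hfg t ht).2.2.2)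
  rw [(hgd.fun_pow 2).deriv, ((hfd.fun_pow (k + 1)).const_mul c).deriv] at hsq
  rw [(hgd.smul_const (matCLM 𝕜 m C)).deriv, smul_smul]
  congr 1
  have h2' : (2 : 𝕜) ≠ 0 := two_ne_zero
  refine mul_left_cancel₀ (mul_ne_zero h2' hgz) ?_
  simp only [Nat.add_sub_cancel, show k + 2 - 1 = k + 1 by omega] at hsq h7
  push_cast at hsq ⊢
  field_simp
  refine mul_left_cancel₀ hgz ?_
  linear_combination (deriv f z) * hsq - (k + 1) * deriv (deriv f) z * h7

end

/-! ### Integration of the equation for `T`. -/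

section NormalForm

/-- The entry `(i, j)` of the matrix of a linear map. -/
noncomputable def entry (𝕜 : Type*) [NontriviallyNormedField 𝕜] {m : ℕ} (i j : Fin m) :
    ((Fin m → 𝕜) →L[𝕜] (Fin m → 𝕜)) →L[𝕜] 𝕜 :=
  (ContinuousLinearMap.proj i).comp (ContinuousLinearMap.apply 𝕜 (Fin m → 𝕜) (Pi.single j 1))

theorem entry_smul (i j : Fin m) (a : 𝕜) (A : (Fin m → 𝕜) →L[𝕜] (Fin m → 𝕜)) :
    entry 𝕜 i j (a • A) = a * entry 𝕜 i j A :=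
  rfl

theorem exists_entry_ne_zero {A : (Fin m → 𝕜) →L[𝕜] (Fin m → 𝕜)} (hm : 1 ≤ m) (hA : IsUnit A) :
    ∃ i j, entry 𝕜 i j A ≠ 0 := by
  by_contra! h
  have hA0 : ∀ j, A (Pi.single j 1) = 0 := fun j => funext fun i => h i j
  have h1 : A = 0 := by
    refine ContinuousLinearMap.coe_injective (LinearMap.pi_ext' fun j => LinearMap.ext_ring ?_)
    simpa using hA0 j
  obtain ⟨u, rfl⟩ := hA
  have h2 := DFunLike.congr_fun u.inv_mul (fun _ => 1)
  rw [clm_mul_apply, h1] at h2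
  exact zero_ne_one (α := 𝕜) (by simpa using congrFun h2 ⟨0, hm⟩)

variable [CompleteSpace 𝕜]

/-- The scalar `g` is an entry of `T` that is nonzero at `z₀`, and `C` is `T z₀` scaled so that this
entry is `1`. -/
theorem hasNormalForm_of_localForm {n : ℕ} {z₀ : 𝕜} {i j : Fin m}
    (hS : ∀ q ∈ S, LocalForm e f T q) (hT₀ : IsUnit (T z₀)) (hf₀ : deriv f z₀ ≠ 0)
    (hij : entry 𝕜 i j (T z₀) ≠ 0)
    (hT : ∀ z ∈ Prod.fst '' S, ∃ a : 𝕜, T z = a • T z₀)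
    (hc : ∀ z ∈ Prod.fst '' S, entry 𝕜 i j (T z) ^ 2 / deriv f z ^ (n - 1) =
      entry 𝕜 i j (T z₀) ^ 2 / deriv f z₀ ^ (n - 1)) : HasNormalForm n e S := by
  refine ⟨f, fun z => entry 𝕜 i j (T z), entry 𝕜 i j (T z₀) ^ 2 / deriv f z₀ ^ (n - 1),
    (matCLM 𝕜 m).symm ((entry 𝕜 i j (T z₀))⁻¹ • T z₀),
    div_ne_zero (pow_ne_zero _ hij) (pow_ne_zero _ hf₀), isUnit_matCLM_iff.1 ?_, ?_, fun q hq => ?_⟩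
  · rw [LinearEquiv.apply_symm_apply]
    exact isUnit_smul_clm (inv_ne_zero hij) hT₀
  · rintro _ ⟨q, hq, rfl⟩
    obtain ⟨h1, h2, h3, -⟩ := (hS q hq).2.self_of_nhds
    refine ⟨h1, h2, (entry 𝕜 i j).contDiff.contDiffAt.comp q.1 h3, ?_⟩
    rw [← hc q.1 ⟨q, hq, rfl⟩, div_mul_cancel₀ _ (pow_ne_zero _ h2)]
  · obtain ⟨a, ha⟩ := hT q.1 ⟨q, hq, rfl⟩
    rw [(hS q hq).1.self_of_nhds, ← matCLM_apply, LinearEquiv.apply_symm_apply]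
    simp only [ha, entry_smul, smul_apply, smul_smul, mul_assoc, mul_inv_cancel₀ hij, mul_one]

variable [CharZero 𝕜]

/-- A nonzero entry of `T` satisfies the same scalar equation, so the quotient of `T` by it has
derivative zero. -/
theorem eventually_eq_smul_of_deriv_eq_smul {z₀ : 𝕜} (hm : 1 ≤ m) {l : 𝕜 → 𝕜}
    (hT : ContDiffAt 𝕜 (smooth 𝕜) T z₀) (hT₀ : IsUnit (T z₀))
    (h : ∀ᶠ z in 𝓝 z₀, deriv T z = l z • T z) :
    ∀ᶠ z in 𝓝 z₀, ∃ a : 𝕜, a ≠ 0 ∧ T z = a • T z₀ := by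
  obtain ⟨i, j, hij⟩ := exists_entry_ne_zero hm hT₀
  have hg : ContDiffAt 𝕜 (smooth 𝕜) (fun z => entry 𝕜 i j (T z)) z₀ :=
    (entry 𝕜 i j).contDiff.contDiffAt.comp z₀ hT
  have hne := hg.continuousAt.eventually_ne hij
  have hR := eventually_eq_of_deriv_eq_zero (f := fun z => (entry 𝕜 i j (T z))⁻¹ • T z)
    ((hg.inv hij).smul hT) ?_
  · filter_upwards [hR, hne] with z h1 h2
    refine ⟨entry 𝕜 i j (T z) * (entry 𝕜 i j (T z₀))⁻¹, mul_ne_zero h2 (inv_ne_zero hij), ?_⟩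
    rw [← smul_smul, ← h1, smul_smul, mul_inv_cancel₀ h2, one_smul]
  · filter_upwards [h, eventually_differentiableAt hT, hne] with z h1 h2 h3
    have h4 : HasDerivAt (fun z => entry 𝕜 i j (T z)) (entry 𝕜 i j (deriv T z)) z :=
      (entry 𝕜 i j).hasFDerivAt.comp_hasDerivAt z h2.hasDerivAt
    rw [((h4.fun_inv h3).fun_smul h2.hasDerivAt).deriv, h1, entry_smul]
    have : (entry 𝕜 i j (T z))⁻¹ * l z +
        -(l z * entry 𝕜 i j (T z)) / entry 𝕜 i j (T z) ^ 2 = 0 := by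
      field_simp
      ring
    refine ContinuousLinearMap.ext fun v => ?_
    simp only [add_apply, smul_apply, smul_smul, ← add_smul, this, zero_smul, zero_apply]

theorem eventually_sq_div_pow_eq {z₀ : 𝕜} (k : ℕ) (i j : Fin m)
    (hT : ContDiffAt 𝕜 (smooth 𝕜) T z₀) (hf : ContDiffAt 𝕜 (smooth 𝕜) f z₀)
    (hf' : deriv f z₀ ≠ 0)
    (h : ∀ᶠ z in 𝓝 z₀, deriv T z = ((k : 𝕜) / 2 * (deriv (deriv f) z / deriv f z)) • T z) :
    ∀ᶠ z in 𝓝 z₀, entry 𝕜 i j (T z) ^ 2 / deriv f z ^ k =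
      entry 𝕜 i j (T z₀) ^ 2 / deriv f z₀ ^ k := by
  have hg : ContDiffAt 𝕜 (smooth 𝕜) (fun z => entry 𝕜 i j (T z)) z₀ :=
    (entry 𝕜 i j).contDiff.contDiffAt.comp z₀ hT
  refine eventually_eq_of_deriv_eq_zero (f := fun z => entry 𝕜 i j (T z) ^ 2 / deriv f z ^ k)
    ((hg.pow 2).div ((deriv_smooth hf).pow k) (pow_ne_zero k hf')) ?_
  filter_upwards [h, eventually_differentiableAt hT, eventually_differentiableAt (deriv_smooth hf),
    (deriv_smooth hf).continuousAt.eventually_ne hf'] with z h1 h2 h3 h4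
  have h5 : HasDerivAt (fun z => entry 𝕜 i j (T z)) (entry 𝕜 i j (deriv T z)) z :=
    (entry 𝕜 i j).hasFDerivAt.comp_hasDerivAt z h2.hasDerivAt
  rw [((h5.fun_pow 2).fun_div (h3.hasDerivAt.fun_pow k) (pow_ne_zero k h4)).deriv, h1, map_smul,
    smul_eq_mul]
  have h2' : (2 : 𝕜) ≠ 0 := two_ne_zero
  refine div_eq_zero_iff.2 (.inl ?_)
  cases k with
  | zero => simp
  | succ k =>
    simp only [Nat.add_sub_cancel]
    field_simp
    push_cast
    ring

theorem LocalForm.exists_hasNormalForm (hm : 1 ≤ m) {n : ℕ} (hn : 2 ≤ n)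
    (h : LocalForm e f T p) (h0 : ∀ᶠ z in 𝓝 p.1, linCoeff f T n (n - 1) z = 0) :
    ∃ S ∈ 𝓝 p, HasNormalForm n e S := by
  obtain ⟨k, rfl⟩ : ∃ k, n = k + 1 := ⟨n - 1, by omega⟩
  obtain ⟨h1, h2, h3, h4⟩ := h.2.self_of_nhds
  have hode := (linCoeff_pred_eq_zero_iff h1 h2 h3 k).1 h0
  obtain ⟨i, j, hij⟩ := exists_entry_ne_zero hm h4
  refine ⟨_, (h.eventually.and (eventually_fst
    ((eventually_eq_smul_of_deriv_eq_smul hm h3 h4 hode).and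
      (eventually_sq_div_pow_eq k i j h3 h1 h2 hode)))),
    hasNormalForm_of_localForm (f := f) (T := T) (fun q hq => hq.1) h4 h2 hij ?_ ?_⟩
  · rintro _ ⟨q, hq, rfl⟩
    obtain ⟨a, -, ha⟩ := hq.2.1
    exact ⟨a, ha⟩
  · rintro _ ⟨q, hq, rfl⟩
    exact hq.2.2

end NormalForm

end Forms

/-! ### Gluing of local forms and the equivalence criteria. -/

section Global

universe u

theorem eq_of_isPreconnected {X Y : Type*} [TopologicalSpace X] {s : Set X} (hs : IsPreconnected s)
    {φ : X → Y} (h : ∀ x ∈ s, ∀ᶠ y in 𝓝[s] x, φ y = φ x) {x y : X} (hx : x ∈ s) (hy : y ∈ s) :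
    φ x = φ y := by
  let : TopologicalSpace Y := ⊥
  have : DiscreteTopology Y := ⟨rfl⟩
  refine hs.constant (f := φ) (fun z hz => ?_) hx hy
  exact (tendsto_const_nhds (x := φ z)).congr' ((h z hz).mono fun t ht => ht.symm)

variable {𝕜 : Type u} [NontriviallyNormedField 𝕜] {m n : ℕ}
  {e : OpenPartialHomeomorph (𝕜 × (Fin m → 𝕜)) (𝕜 × (Fin m → 𝕜))} {f : 𝕜 → 𝕜}
  {T : 𝕜 → (Fin m → 𝕜) →L[𝕜] (Fin m → 𝕜)} {p : 𝕜 × (Fin m → 𝕜)}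

/-- Shows that `T` is determined by `e`, so that two local forms agree wherever both hold. -/
theorem LocalForm.fderiv_snd_eq (h : LocalForm e f T p) :
    (ContinuousLinearMap.snd 𝕜 𝕜 (Fin m → 𝕜)).comp
      ((fderiv 𝕜 e p).comp (ContinuousLinearMap.inr 𝕜 𝕜 (Fin m → 𝕜))) = T p.1 := by
  obtain ⟨h1, -, h3, -⟩ := h.2.self_of_nhds
  have hfd := (eventually_differentiableAt h1).self_of_nhds.hasFDerivAt.comp p hasFDerivAt_fst
  have hTd := (eventually_differentiableAt h3).self_of_nhds.hasFDerivAt.comp p hasFDerivAt_fst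
  have hd := (hfd.prodMk (hTd.clm_apply hasFDerivAt_snd)).congr_of_eventuallyEq h.1
  rw [hd.fderiv]
  ext1 v
  simp

theorem exists_forall_localForm (hsl : ∀ z : 𝕜, IsPreconnected {w : Fin m → 𝕜 | (z, w) ∈ e.source})
    (h : ∀ p ∈ e.source, ∃ f T, LocalForm e f T p) :
    ∃ f T, ∀ p ∈ e.source, LocalForm e f T p := by
  classical
  -- The intrinsic value of `(f, T)` at a point of the domain; it is locally constant in `w`, hence
  -- constant on each connected slice.
  let Φ : 𝕜 × (Fin m → 𝕜) → 𝕜 × ((Fin m → 𝕜) →L[𝕜] (Fin m → 𝕜)) := fun q =>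
    ((e q).1, (ContinuousLinearMap.snd 𝕜 𝕜 (Fin m → 𝕜)).comp
      ((fderiv 𝕜 e q).comp (ContinuousLinearMap.inr 𝕜 𝕜 (Fin m → 𝕜))))
  have hΦ : ∀ {f T p}, LocalForm e f T p → Φ p = (f p.1, T p.1) := fun hf =>
    Prod.ext (congrArg Prod.fst hf.1.self_of_nhds :) hf.fderiv_snd_eq
  have hconst : ∀ z w w', (z, w) ∈ e.source → (z, w') ∈ e.source → Φ (z, w) = Φ (z, w') := by
    intro z w w' hw hw'
    refine eq_of_isPreconnected (hsl z) (φ := fun w => Φ (z, w)) (fun v hv => ?_) hw hw'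
    obtain ⟨f, T, hf⟩ := h _ hv
    have hc : Filter.Tendsto (fun w => (z, w)) (𝓝[{w | (z, w) ∈ e.source}] v) (𝓝 (z, v)) :=
      ((Continuous.prodMk_right z).tendsto v).mono_left nhdsWithin_le_nhds
    filter_upwards [hc.eventually hf.eventually] with y hy
    rw [hΦ hy, hΦ hf]
  let Ψ : 𝕜 → 𝕜 × ((Fin m → 𝕜) →L[𝕜] (Fin m → 𝕜)) := fun z =>
    if hz : ∃ w, (z, w) ∈ e.source then Φ (z, hz.choose) else 0
  have hΨ : ∀ q ∈ e.source, Ψ q.1 = Φ q := by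
    intro q hq
    have hz : ∃ w, (q.1, w) ∈ e.source := ⟨q.2, hq⟩
    simp only [Ψ, dif_pos hz]
    exact hconst q.1 _ q.2 hz.choose_spec hq
  refine ⟨fun z => (Ψ z).1, fun z => (Ψ z).2, fun p hp => ?_⟩
  obtain ⟨f, T, hf⟩ := h p hp
  have hline : Filter.Tendsto (fun z => (z, p.2)) (𝓝 p.1) (𝓝 p) :=
    (Continuous.prodMk_left p.2).tendsto p.1
  have heq : ∀ᶠ z in 𝓝 p.1, Ψ z = (f z, T z) := by
    filter_upwards [hline.eventually hf.eventually,
      hline.eventually (e.open_source.mem_nhds hp)] with z h1 h2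
    rw [hΨ (z, p.2) h2, hΦ h1]
  refine ⟨?_, ?_⟩
  · filter_upwards [hf.1, eventually_fst heq] with q h1 h2
    rw [h1, h2]
  · filter_upwards [hf.2, heq.eventually_nhds] with z h1 h2
    have hf1 : (fun z => (Ψ z).1) =ᶠ[𝓝 z] f := h2.mono fun t ht => congrArg Prod.fst ht
    have hT1 : (fun z => (Ψ z).2) =ᶠ[𝓝 z] T := h2.mono fun t ht => congrArg Prod.snd ht
    refine ⟨h1.1.congr_of_eventuallyEq hf1, by rw [hf1.deriv_eq]; exact h1.2.1,
      h1.2.2.1.congr_of_eventuallyEq hT1, by rw [hT1.eq_of_nhds]; exact h1.2.2.2⟩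

theorem generalFamily_const (B : ℕ → Matrix (Fin m) (Fin m) 𝕜) (x : 𝕜) :
    GeneralFamily n (fun k _ => B k) x :=
  Filter.Eventually.of_forall fun _ _ _ _ _ => contDiffAt_const

/-- The only nonzero coefficient has index `n ≠ 1`, so the necessity argument of (a) also serves
(b). -/
theorem normalFamily_lastOne (hn : 2 ≤ n) (x : 𝕜) : NormalFamily n (lastOne 𝕜 m n) x :=
  ⟨generalFamily_const _ x, Filter.Eventually.of_forall fun _ => if_neg (by omega)⟩

theorem normalFamily_zero (x : 𝕜) : NormalFamily n (fun _ _ => 0 : Coeffs 𝕜 m) x :=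
  ⟨generalFamily_const _ x, Filter.Eventually.of_forall fun _ => rfl⟩

variable [CharZero 𝕜]

theorem IsEquivalence.linCoeff_pred_eq_zero (hn : 2 ≤ n) (h : IsEquivalence n (NormalFamily n) e)
    (hp : p ∈ e.source) (hf : LocalForm e f T p) :
    ∀ᶠ z in 𝓝 p.1, linCoeff f T n (n - 1) z = 0 := by
  obtain ⟨H₀, hH, h₀⟩ := h p hp _ (normalFamily_zero (n := n) (e p).1)
  exact hf.linCoeff_pred_eq_zero hn hH.2 h₀

variable [CompleteSpace 𝕜]

theorem hasNormalForm_source (hm : 1 ≤ m) (hn : 2 ≤ n)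
    (hI : IsPreconnected (Prod.fst '' e.source)) (h : ∀ p ∈ e.source, LocalForm e f T p)
    (h0 : ∀ p ∈ e.source, ∀ᶠ z in 𝓝 p.1, linCoeff f T n (n - 1) z = 0) :
    HasNormalForm n e e.source := by
  obtain ⟨k, rfl⟩ : ∃ k, n = k + 1 := ⟨n - 1, by omega⟩
  rcases e.source.eq_empty_or_nonempty with hS | ⟨p, hp⟩
  · rw [hS]
    exact ⟨id, fun _ => 1, 1, 1, one_ne_zero, isUnit_one, by simp, by simp⟩
  have hode : ∀ q ∈ e.source, ∀ᶠ z in 𝓝 q.1,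
      deriv T z = ((k : 𝕜) / 2 * (deriv (deriv f) z / deriv f z)) • T z := fun q hq => by
    obtain ⟨h1, h2, h3, -⟩ := (h q hq).2.self_of_nhds
    exact (linCoeff_pred_eq_zero_iff h1 h2 h3 k).1 (h0 q hq)
  obtain ⟨h1, h2, h3, h4⟩ := (h p hp).2.self_of_nhds
  obtain ⟨i, j, hij⟩ := exists_entry_ne_zero hm h4
  have hp' : p.1 ∈ Prod.fst '' e.source := ⟨p, hp, rfl⟩
  refine hasNormalForm_of_localForm h h4 h2 hij (fun z hz => ?_) fun z hz => ?_
  · have hspan := eq_of_isPreconnected hI (φ := fun z => Submodule.span 𝕜 {T z}) ?_ hz hp'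
    · have hmem : T z ∈ Submodule.span 𝕜 {T p.1} := by
        rw [← hspan]
        exact Submodule.mem_span_singleton_self (T z)
      obtain ⟨a, ha⟩ := Submodule.mem_span_singleton.1 hmem
      exact ⟨a, ha.symm⟩
    · rintro _ ⟨q, hq, rfl⟩
      obtain ⟨-, -, h7, h8⟩ := (h q hq).2.self_of_nhds
      filter_upwards [nhdsWithin_le_nhds
        (eventually_eq_smul_of_deriv_eq_smul hm h7 h8 (hode q hq))] with t ⟨a, ha, hta⟩
      rw [hta]
      exact Submodule.span_singleton_smul_eq (IsUnit.mk0 a ha) (T q.1)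
  · refine eq_of_isPreconnected hI
      (φ := fun z => entry 𝕜 i j (T z) ^ 2 / deriv f z ^ (k + 1 - 1)) ?_
      hz hp'
    rintro _ ⟨q, hq, rfl⟩
    obtain ⟨h5, h6, h7, -⟩ := (h q hq).2.self_of_nhds
    exact nhdsWithin_le_nhds (eventually_sq_div_pow_eq k i j h7 h5 h6 (hode q hq))

theorem isEquivalence_generalFamily_iff (hm : 1 ≤ m) (hn : 2 ≤ n) (he : IsPointTransformation e) :
    IsEquivalence n (GeneralFamily n) e ↔ ∀ p ∈ e.source, ∃ f T, LocalForm e f T p := by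
  refine ⟨fun h p hp => ?_, fun h p hp B hB => ?_⟩
  · obtain ⟨H₀, -, h₀⟩ := h p hp _ (normalFamily_zero (n := n) (e p).1).1
    obtain ⟨H₁, -, h₁⟩ := h p hp _ (normalFamily_lastOne hn (e p).1).1
    exact exists_localForm hm hn he hp h₀ h₁
  · obtain ⟨f, T, hf⟩ := h p hp
    exact ⟨_, hf.generalFamily hB, hf.transformsAt n B⟩

theorem IsEquivalence.exists_localForm (hm : 1 ≤ m) (hn : 2 ≤ n) (he : IsPointTransformation e)
    (h : IsEquivalence n (NormalFamily n) e) (hp : p ∈ e.source) : ∃ f T, LocalForm e f T p := by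
  obtain ⟨H₀, -, h₀⟩ := h p hp _ (normalFamily_zero (n := n) (e p).1)
  obtain ⟨H₁, -, h₁⟩ := h p hp _ (normalFamily_lastOne hn (e p).1)
  exact LinearSystem.exists_localForm hm hn he hp h₀ h₁

theorem isEquivalence_generalFamily_iff_hasStandardForm (hm : 1 ≤ m) (hn : 2 ≤ n)
    (he : IsPointTransformation e) :
    IsEquivalence n (GeneralFamily n) e ↔ ∀ p ∈ e.source, ∃ S ∈ 𝓝 p, HasStandardForm e S := by
  rw [isEquivalence_generalFamily_iff hm hn he]
  refine forall₂_congr fun p _ => ⟨fun ⟨f, T, h⟩ => ?_, fun ⟨S, hS, h⟩ => h.exists_localForm hS⟩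
  exact ⟨_, h.eventually, hasStandardForm_of_localForm fun q hq => hq⟩

theorem isEquivalence_normalFamily_iff_hasNormalForm (hm : 1 ≤ m) (hn : 2 ≤ n)
    (he : IsPointTransformation e) :
    IsEquivalence n (NormalFamily n) e ↔ ∀ p ∈ e.source, ∃ S ∈ 𝓝 p, HasNormalForm n e S := by
  refine ⟨fun h p hp => ?_, fun h p hp B hB => ?_⟩
  · obtain ⟨f, T, hf⟩ := h.exists_localForm hm hn he hp
    exact hf.exists_hasNormalForm hm hn (h.linCoeff_pred_eq_zero hn hp hf)
  · obtain ⟨S, hS, hN⟩ := h p hp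
    obtain ⟨f, T, hf, h0⟩ := hN.exists_localForm hn hS
    exact ⟨_, hf.normalFamily hn hB h0, hf.transformsAt n B⟩

end Global

end LinearSystem

theorem theorem1 {𝕜 : Type*} [NontriviallyNormedField 𝕜] [CompleteSpace 𝕜] [CharZero 𝕜]
    {m n : ℕ} (hm : 1 ≤ m) (hn : 2 ≤ n)
    (e : OpenPartialHomeomorph (𝕜 × (Fin m → 𝕜)) (𝕜 × (Fin m → 𝕜)))
    (he : LinearSystem.IsPointTransformation e) :
    (LinearSystem.IsEquivalence n (LinearSystem.GeneralFamily n) e ↔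
      ∀ p ∈ e.source, ∃ S ∈ 𝓝 p, LinearSystem.HasStandardForm e S) ∧
    (LinearSystem.IsEquivalence n (LinearSystem.NormalFamily n) e ↔
      ∀ p ∈ e.source, ∃ S ∈ 𝓝 p, LinearSystem.HasNormalForm n e S) ∧
    ((∀ z : 𝕜, IsPreconnected {w : Fin m → 𝕜 | (z, w) ∈ e.source}) →
      (LinearSystem.IsEquivalence n (LinearSystem.GeneralFamily n) e ↔
        LinearSystem.HasStandardForm e e.source) ∧
      (IsPreconnected (Prod.fst '' e.source) →
        (LinearSystem.IsEquivalence n (LinearSystem.NormalFamily n) e ↔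
          LinearSystem.HasNormalForm n e e.source))) := by
  have ha := LinearSystem.isEquivalence_generalFamily_iff_hasStandardForm hm hn he
  have hb := LinearSystem.isEquivalence_normalFamily_iff_hasNormalForm hm hn he
  refine ⟨ha, hb, fun hsl => ⟨⟨fun h => ?_, fun h => ?_⟩, fun hI => ⟨fun h => ?_, fun h => ?_⟩⟩⟩
  · obtain ⟨f, T, hf⟩ := LinearSystem.exists_forall_localForm hsl
      ((LinearSystem.isEquivalence_generalFamily_iff hm hn he).1 h)
    exact LinearSystem.hasStandardForm_of_localForm hf
  · exact ha.2 fun p hp => ⟨e.source, e.open_source.mem_nhds hp, h⟩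
  · obtain ⟨f, T, hf⟩ := LinearSystem.exists_forall_localForm hsl
      fun p hp => h.exists_localForm hm hn he hp
    exact LinearSystem.hasNormalForm_source hm hn hI hf
      fun p hp => h.linCoeff_pred_eq_zero hn hp (hf p hp)
  · exact hb.2 fun p hp => ⟨e.source, e.open_source.mem_nhds hp, h⟩
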